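/- Let $\mathcal T$ be a triangulated category (satisfying the octahedral axiom; it is not assumed to be algebraic) with shift functor $X\mapsto X[1]$, and let $\mathcal H\subset\mathcal T$ be a full additive subcategory such that 1. (admissible) $\operatorname{Hom}_{\mathcal T}(X,Y[-n])=0$ for all $X,Y\in\mathcal H$ and all $n>0$, and $\mathcal H$ is closed under extensions: if $X\to Y\to Z\to X[1]$ is an exact triangle in $\mathcal T$ with $X,Z\in\mathcal H$, then $Y\in\mathcal H$; 2. (abelian) $\mathcal H$ is an abelian category, and every short exact sequence $0\to X\xrightarrow{f}Y\xrightarrow{g}Z\to 0$ in $\mathcal H$ can be completed to an exact triangle $X\xrightarrow{f}Y\xrightarrow{g}Z\xrightarrow{h}X[1]$ in $\mathcal T$; 3. (hereditary) $\operatorname{Hom}_{\mathcal T}(X,Y[n])=0$ for all $X,Y\in\mathcal H$ and all integers $n\neq 0,1$. Let $D^b(\mathcal H)$ be the bounded derived category of $\mathcal H$, and let $\operatorname{thick}(\mathcal H)$ be the smallest full triangulated subcategory of $\mathcal T$ that contains $\mathcal H$ and is closed under direct summands. Then the embedding of $\mathcal H$ lifts to a triangle equivalence: there is an equivalence of categories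 $F\colon D^b(\mathcal H)\xrightarrow{\sim}\operatorname{thick}(\mathcal H)$ which commutes with the shift functors (up to specified natural isomorphism) and sends exact triangles to exact triangles, and whose composite with the canonical inclusion $\mathcal H\to D^b(\mathcal H)$ (complexes concentrated in degree $0$) is naturally isomorphic to the inclusion $\mathcal H\to\operatorname{thick}(\mathcal H)$. -/

import Mathlib

open CategoryTheory Limits Pretriangulated

universe w v u

namespace CategoryTheory.ObjectProperty

variable {T : Type u} [Category.{v} T] [HasZeroObject T] [HasShift T ℤ] [Preadditive T]
  [∀ n : ℤ, (shiftFunctor T n).Additive] [Pretriangulated T] (H : ObjectProperty T)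

/-- An admissible subcategory of a triangulated category `T`, given by its class of objects `H`:
a full additive subcategory, closed under extensions, with no nonzero morphisms from its objects
to negative shifts of its objects. (Additive means that it
contains a zero object and is closed under binary direct sums; the latter are extensions.) -/
class IsAdmissible : Prop extends H.ContainsZero where
  prop_of_distTriang (S : Triangle T) (hS : S ∈ distTriang T) :
    H S.obj₁ → H S.obj₃ → H S.obj₂
  hom_shift_neg_eq_zero {X Y : T} (hX : H X) (hY : H Y) (n : ℤ) (hn : 0 < n)
    (f : X ⟶ Y⟦-n⟧) : f = 0

/-- An admissible subcategory is hereditary if there are no nonzero morphisms from its objects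
to the `n`-th shifts of its objects, for every integer `n ≠ 0, 1`. -/
class IsAdmissibleHereditary : Prop extends H.IsAdmissible where
  hom_shift_eq_zero {X Y : T} (hX : H X) (hY : H Y) (n : ℤ) (hn₀ : n ≠ 0) (hn₁ : n ≠ 1)
    (f : X ⟶ Y⟦n⟧) : f = 0

/-- An admissible abelian subcategory: an admissible subcategory which is an abelian category
(it has kernels and cokernels, monomorphisms are kernels, epimorphisms are cokernels), and whose
exact structure inherited from `T`, i.e. the sequences `X ⟶ Y ⟶ Z` in `H` that can be completed
to a distinguished triangle of `T`, is the abelian one, i.e. contains all short exact sequences.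
(Conversely a sequence in `H` that completes to a distinguished triangle is always
short exact in `H`, because of the vanishing of the negative Hom groups.) -/
class IsAdmissibleAbelian : Prop extends H.IsAdmissible where
  hasKernels : HasKernels H.FullSubcategory
  hasCokernels : HasCokernels H.FullSubcategory
  isNormalMonoCategory : IsNormalMonoCategory H.FullSubcategory
  isNormalEpiCategory : IsNormalEpiCategory H.FullSubcategory
  exists_distTriang (S : ShortComplex H.FullSubcategory) (hS : S.ShortExact) :
    ∃ h : H.ι.obj S.X₃ ⟶ (H.ι.obj S.X₁)⟦(1 : ℤ)⟧,
      Triangle.mk (H.ι.map S.f) (H.ι.map S.g) h ∈ distTriang T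

instance IsAdmissible.isClosedUnderIsomorphisms [H.IsAdmissible] :
    H.IsClosedUnderIsomorphisms where
  of_iso {X Y} e hX := by
    obtain ⟨Z, hZ, hHZ⟩ := H.exists_prop_of_containsZero
    refine IsAdmissible.prop_of_distTriang
      (Triangle.mk e.hom (0 : Y ⟶ Z) (0 : Z ⟶ X⟦(1 : ℤ)⟧)) ?_ hX hHZ
    exact isomorphic_distinguished _ (contractible_distinguished X) _
      (Triangle.isoMk _ _ (Iso.refl _) e.symm (hZ.iso (isZero_zero T))
        (by change e.hom ≫ e.inv = 𝟙 X ≫ 𝟙 X; simp)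
        ((isZero_zero T).eq_of_tgt _ _) (hZ.eq_of_src _ _))

instance IsAdmissible.isClosedUnderBinaryProducts [H.IsAdmissible] :
    H.IsClosedUnderBinaryProducts where
  limitsOfShape_le := by
    rintro X ⟨p⟩
    have e : X ≅ p.diag.obj ⟨.left⟩ ⨯ p.diag.obj ⟨.right⟩ :=
      p.isLimit.conePointUniqueUpToIso (limit.isLimit _) ≪≫
        HasLimit.isoOfNatIso (diagramIsoPair _)
    exact H.prop_of_iso e.symm (IsAdmissible.prop_of_distTriang _
      (binaryProductTriangle_distinguished _ _) (p.prop_diag_obj _) (p.prop_diag_obj _))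

instance IsAdmissible.isClosedUnderFiniteProducts [H.IsAdmissible] :
    H.IsClosedUnderFiniteProducts := .mk'

/-- An admissible abelian subcategory, as an abelian category; the additive structure on its
Hom sets is that of `T`. -/
noncomputable instance IsAdmissibleAbelian.abelian [H.IsAdmissibleAbelian] :
    Abelian H.FullSubcategory where
  toIsNormalMonoCategory := IsAdmissibleAbelian.isNormalMonoCategory
  toIsNormalEpiCategory := IsAdmissibleAbelian.isNormalEpiCategory
  has_kernels := IsAdmissibleAbelian.hasKernels
  has_cokernels := IsAdmissibleAbelian.hasCokernels

end CategoryTheory.ObjectProperty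

/-- The canonical inclusion of an abelian category in its bounded derived category, as the
complexes concentrated in degree `0`. -/
noncomputable def DerivedCategory.Bounded.single₀ (A : Type u) [Category.{v} A] [Abelian A]
    [HasDerivedCategory.{w} A] : A ⥤ DerivedCategory.Bounded A :=
  DerivedCategory.TStructure.t.bounded.lift (DerivedCategory.singleFunctor A 0)
    (fun _ => ⟨⟨0, inferInstance⟩, ⟨0, inferInstance⟩⟩)

set_option linter.unusedSectionVars false

/-! Write `A` for `H` as an abelian category and `D` for its bounded derived category. Both `D` and
`T` contain `A`, and in both a morphism `Z ⟶ X⟦1⟧` between objects of `A` is the class of a short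
exact sequence: its triangle has its middle term in `A`. Comparing these triangles (`ExtRel`)
identifies the morphisms of degree 0 and 1 in the two categories. In `T` the other degrees vanish by
hypothesis. They vanish in `D` too: `Ext¹` is right exact in `A` because `T` is hereditary, and the
positive Ext groups of `D` are effaceable (`Functor.IsHereditaryEmbedding.of_effaceable`). So `D`
and `T` have the same full subcategory of shifted objects of `A`, and every object of `D` is a
finite direct sum of such shifts (`SumShifts.of_tStructure`).

As `T` has no model by complexes, the functor is built by a Yoneda argument. A `Match` of `X : D`
with `M : T` identifies the two functors which they represent on the shifted objects of `A`. For
sums of shifts there is a match such that morphisms correspond uniquely (`Match.Rigid`). Choosing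
such an `M` for each `X` gives a fully faithful additive functor (`MatchChoice.functor`), and
uniqueness yields the commutation with shifts and its coherence.

The hard point is exactness, since the third morphism of a triangle is not determined by the first
two. It is enough that each morphism has one distinguished triangle sent to a distinguished triangle
(`Functor.PreservesCone`). This holds for short exact sequences, hence for morphisms of `A`, and
then for all morphisms by splitting source and target. Each step uses the octahedral axiom in `D`
and in `T`; the connecting morphisms so obtained correspond because Hom vanishing between the two
summands makes them unique (`SplitData.eq_of_source`, `SplitData.eq_of_target`).

Finally `D` is idempotent complete, so the essential image is a triangulated subcategory closed
under retracts; it is the thick subcategory generated by `H`. -/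

namespace CategoryTheory

open Category Preadditive ZeroObject

/-! ### Distinguished triangles given by three morphisms -/

section UnbundledTriangles

variable {T : Type*} [Category* T] [HasZeroObject T] [HasShift T ℤ]
  [Preadditive T] [∀ n : ℤ, (shiftFunctor T n).Additive] [Pretriangulated T]

namespace Pretriangulated

section

variable {X Y Z : T} {f : X ⟶ Y} {g : Y ⟶ Z} {h : Z ⟶ X⟦(1 : ℤ)⟧}
  (hT : Triangle.mk f g h ∈ distTriang T)

include hT

lemma distTriang_comp₁₂ : f ≫ g = 0 := comp_distTriang_mor_zero₁₂ _ hT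

lemma distTriang_comp₂₃ : g ≫ h = 0 := comp_distTriang_mor_zero₂₃ _ hT

lemma distTriang_yoneda₃ {W : T} (x : Z ⟶ W) (hx : g ≫ x = 0) :
    ∃ y : X⟦(1 : ℤ)⟧ ⟶ W, x = h ≫ y :=
  Triangle.yoneda_exact₃ _ hT x hx

lemma distTriang_coyoneda₁ {W : T} (x : W ⟶ X⟦(1 : ℤ)⟧) (hx : x ≫ f⟦(1 : ℤ)⟧' = 0) :
    ∃ y : W ⟶ Z, x = y ≫ h :=
  Triangle.coyoneda_exact₁ _ hT x hx

lemma distTriang_rotate : Triangle.mk g h (-f⟦(1 : ℤ)⟧') ∈ distTriang T :=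
  rot_of_distTriang _ hT

variable {X' Y' Z' : T} {f' : X' ⟶ Y'} {g' : Y' ⟶ Z'} {h' : Z' ⟶ X'⟦(1 : ℤ)⟧}
  (hT' : Triangle.mk f' g' h' ∈ distTriang T)

include hT'

lemma distTriang_complete₃ (a : X ⟶ X') (b : Y ⟶ Y') (comm : f ≫ b = a ≫ f') :
    ∃ c : Z ⟶ Z', g ≫ c = b ≫ g' ∧ h ≫ a⟦(1 : ℤ)⟧' = c ≫ h' :=
  complete_distinguished_triangle_morphism _ _ hT hT' a b comm

lemma distTriang_complete₂ (a : X ⟶ X') (c : Z ⟶ Z') (comm : h ≫ a⟦(1 : ℤ)⟧' = c ≫ h') :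
    ∃ b : Y ⟶ Y', f ≫ b = a ≫ f' ∧ g ≫ c = b ≫ g' :=
  complete_distinguished_triangle_morphism₂ _ _ hT hT' a c comm

lemma distTriang_iso₃ (a : X ≅ X') (b : Y ≅ Y') (comm : f ≫ b.hom = a.hom ≫ f') :
    ∃ c : Z ≅ Z', g ≫ c.hom = b.hom ≫ g' ∧ h ≫ a.hom⟦(1 : ℤ)⟧' = c.hom ≫ h' := by
  let e := isoTriangleOfIso₁₂ _ _ hT hT' a b comm
  exact ⟨Triangle.π₃.mapIso e, e.hom.comm₂, e.hom.comm₃⟩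

lemma distTriang_iso₁ (b : Y ≅ Y') (c : Z ≅ Z') (comm : g ≫ c.hom = b.hom ≫ g') :
    ∃ a : X ≅ X', f ≫ b.hom = a.hom ≫ f' ∧ h ≫ a.hom⟦(1 : ℤ)⟧' = c.hom ≫ h' := by
  obtain ⟨a, ha₁, ha₂⟩ : ∃ a : X ⟶ X', f ≫ b.hom = a ≫ f' ∧ h ≫ a⟦(1 : ℤ)⟧' = c.hom ≫ h' :=
    complete_distinguished_triangle_morphism₁ _ _ hT hT' b.hom c.hom comm
  let φ : Triangle.mk f g h ⟶ Triangle.mk f' g' h' :=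
    Triangle.homMk _ _ a b.hom c.hom ha₁ comm ha₂
  have : IsIso a := isIso₁_of_isIso₂₃ φ hT hT' (inferInstanceAs (IsIso b.hom))
    (inferInstanceAs (IsIso c.hom))
  exact ⟨asIso a, ha₁, ha₂⟩

omit hT in
lemma distTriang_of_iso (a : X ≅ X') (b : Y ≅ Y') (c : Z ≅ Z') (h₁ : f ≫ b.hom = a.hom ≫ f')
    (h₂ : g ≫ c.hom = b.hom ≫ g') (h₃ : h ≫ a.hom⟦(1 : ℤ)⟧' = c.hom ≫ h') :
    Triangle.mk f g h ∈ distTriang T :=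
  isomorphic_distinguished _ hT' _ (Triangle.isoMk _ _ a b c h₁ h₂ h₃)

end

end Pretriangulated

end UnbundledTriangles

/-! ### Embeddings of an abelian category that realize its extensions -/

section ExtensionEmbedding

variable {A T : Type*} [Category* A] [Abelian A] [Category* T] [HasZeroObject T] [HasShift T ℤ]
  [Preadditive T] [∀ n : ℤ, (shiftFunctor T n).Additive] [Pretriangulated T]

/-- A fully faithful additive functor `ι` from an abelian category to a triangulated category,
with no nonzero morphisms from objects `ι X` to negative shifts of objects `ι Y`, and for which
the short exact sequences and the morphisms `ι Z ⟶ (ι X)⟦1⟧` correspond to each other through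
distinguished triangles. -/
class Functor.IsExtensionEmbedding (ι : A ⥤ T) : Prop where
  full : ι.Full
  faithful : ι.Faithful
  additive : ι.Additive
  hom_shift_neg_eq_zero {X Y : A} (n : ℤ) (hn : n < 0) (f : ι.obj X ⟶ (ι.obj Y)⟦n⟧) : f = 0
  exists_distTriang (S : ShortComplex A) (hS : S.ShortExact) :
    ∃ h : ι.obj S.X₃ ⟶ (ι.obj S.X₁)⟦(1 : ℤ)⟧,
      Triangle.mk (ι.map S.f) (ι.map S.g) h ∈ distTriang T
  exists_extension {X Z : A} (h : ι.obj Z ⟶ (ι.obj X)⟦(1 : ℤ)⟧) :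
    ∃ (Y : A) (f : X ⟶ Y) (g : Y ⟶ Z), Triangle.mk (ι.map f) (ι.map g) h ∈ distTriang T

attribute [instance] Functor.IsExtensionEmbedding.full Functor.IsExtensionEmbedding.faithful
  Functor.IsExtensionEmbedding.additive

/-- An extension embedding is hereditary if there are no nonzero morphisms from objects `ι X`
to the `n`-th shifts of objects `ι Y` for `n ≠ 0, 1`. -/
class Functor.IsHereditaryEmbedding (ι : A ⥤ T) : Prop extends ι.IsExtensionEmbedding where
  hom_shift_eq_zero {X Y : A} (n : ℤ) (hn₀ : n ≠ 0) (hn₁ : n ≠ 1)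
    (f : ι.obj X ⟶ (ι.obj Y)⟦n⟧) : f = 0

namespace Functor.IsExtensionEmbedding

variable (ι : A ⥤ T) [ι.IsExtensionEmbedding]

/-- As in the heart of a t-structure, the vanishing of negative Hom groups makes `f` a kernel of `g`
and `g` a cokernel of `f`. -/
lemma shortExact_of_distTriang {X Y Z : A} {f : X ⟶ Y} {g : Y ⟶ Z}
    {h : ι.obj Z ⟶ (ι.obj X)⟦(1 : ℤ)⟧} (hT : Triangle.mk (ι.map f) (ι.map g) h ∈ distTriang T) :
    ∃ w : f ≫ g = 0, (ShortComplex.mk f g w).ShortExact := by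
  have hι : ∀ ⦃X Y : A⦄ ⦃n : ℤ⦄ (f : ι.obj X ⟶ (ι.obj Y)⟦n⟧), n < 0 → f = 0 :=
    fun _ _ n f hn ↦ hom_shift_neg_eq_zero n hn f
  have hk := Triangulated.AbelianSubcategory.isLimitKernelForkOfDistTriang hι f g h hT
  have hc := Triangulated.AbelianSubcategory.isColimitCokernelCoforkOfDistTriang hι f g h hT
  have w : f ≫ g = 0 := ι.map_injective (by
    rw [ι.map_comp, distTriang_comp₁₂ hT, ι.map_zero])
  refine ⟨w, ?_⟩
  have : Mono f := mono_of_isLimit_fork hk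
  have : Epi g := epi_of_isColimit_cofork hc
  exact { exact := ShortComplex.exact_of_f_is_kernel _ hk }

end Functor.IsExtensionEmbedding

end ExtensionEmbedding

/-! ### Degree one morphisms as extension classes -/

section ExtRel

open Functor.IsExtensionEmbedding

variable {A D T : Type*} [Category* A] [Abelian A]
  [Category* D] [HasZeroObject D] [HasShift D ℤ]
  [Preadditive D] [∀ n : ℤ, (shiftFunctor D n).Additive] [Pretriangulated D]
  [Category* T] [HasZeroObject T] [HasShift T ℤ]
  [Preadditive T] [∀ n : ℤ, (shiftFunctor T n).Additive] [Pretriangulated T]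
  (ι₁ : A ⥤ D) (ι₂ : A ⥤ T)

/-- The relation between the degree one morphisms in two extension embeddings of the same abelian
category which are classes of the same extension. -/
def ExtRel {X Z : A} (x : ι₁.obj Z ⟶ (ι₁.obj X)⟦(1 : ℤ)⟧) (y : ι₂.obj Z ⟶ (ι₂.obj X)⟦(1 : ℤ)⟧) :
    Prop :=
  ∃ (Y : A) (f : X ⟶ Y) (g : Y ⟶ Z), Triangle.mk (ι₁.map f) (ι₁.map g) x ∈ distTriang D ∧
    Triangle.mk (ι₂.map f) (ι₂.map g) y ∈ distTriang T

namespace ExtRel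

variable {ι₁ ι₂}

lemma symm {X Z : A} {x : ι₁.obj Z ⟶ (ι₁.obj X)⟦(1 : ℤ)⟧} {y : ι₂.obj Z ⟶ (ι₂.obj X)⟦(1 : ℤ)⟧}
    (h : ExtRel ι₁ ι₂ x y) : ExtRel ι₂ ι₁ y x := by
  obtain ⟨Y, f, g, h₁, h₂⟩ := h
  exact ⟨Y, f, g, h₂, h₁⟩

variable [ι₁.IsExtensionEmbedding] [ι₂.IsExtensionEmbedding]

/-- A commutative square of classes in `D` extends to a morphism of extensions, whose middle
component `b` comes from `A` and can be carried to `T`. There it induces some `c` on the quotients,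
and `c = v` because `g` is an epimorphism of `A`. Uniqueness of the corresponding class follows by
taking identities for `u` and `v`. -/
lemma naturality {X Z X' Z' : A}
    {x : ι₁.obj Z ⟶ (ι₁.obj X)⟦(1 : ℤ)⟧} {y : ι₂.obj Z ⟶ (ι₂.obj X)⟦(1 : ℤ)⟧}
    {x' : ι₁.obj Z' ⟶ (ι₁.obj X')⟦(1 : ℤ)⟧} {y' : ι₂.obj Z' ⟶ (ι₂.obj X')⟦(1 : ℤ)⟧}
    (h : ExtRel ι₁ ι₂ x y) (h' : ExtRel ι₁ ι₂ x' y') (u : X ⟶ X') (v : Z ⟶ Z')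
    (comm : x ≫ (ι₁.map u)⟦(1 : ℤ)⟧' = ι₁.map v ≫ x') :
    y ≫ (ι₂.map u)⟦(1 : ℤ)⟧' = ι₂.map v ≫ y' := by
  obtain ⟨Y, f, g, h₁, h₂⟩ := h
  obtain ⟨Y', f', g', h₁', h₂'⟩ := h'
  obtain ⟨b, hb₁, hb₂⟩ := distTriang_complete₂ h₁ h₁'
    (ι₁.map u) (ι₁.map v) comm
  obtain ⟨b, rfl⟩ := ι₁.map_surjective b
  have hb₁ : f ≫ b = u ≫ f' := ι₁.map_injective (by simpa using hb₁)
  have hb₂ : g ≫ v = b ≫ g' := ι₁.map_injective (by simpa using hb₂)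
  obtain ⟨c, hc₁, hc₂⟩ := distTriang_complete₃ h₂ h₂'
    (ι₂.map u) (ι₂.map b) (by simp [← Functor.map_comp, hb₁])
  obtain ⟨c, rfl⟩ := ι₂.map_surjective c
  have hc₁ : g ≫ c = b ≫ g' := ι₂.map_injective (by simpa using hc₁)
  obtain ⟨_, hS⟩ := shortExact_of_distTriang ι₂ h₂
  have := hS.epi_g
  dsimp at this
  obtain rfl : c = v := by rw [← cancel_epi g, hc₁, hb₂]
  exact hc₂

variable (ι₂) in
lemma existsUnique_right {X Z : A} (x : ι₁.obj Z ⟶ (ι₁.obj X)⟦(1 : ℤ)⟧) :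
    ∃! y, ExtRel ι₁ ι₂ x y := by
  obtain ⟨Y, f, g, h₁⟩ := exists_extension x
  obtain ⟨_, hS⟩ := shortExact_of_distTriang ι₁ h₁
  obtain ⟨y, h₂⟩ := exists_distTriang (ι := ι₂) _ hS
  refine ⟨y, ⟨Y, f, g, h₁, h₂⟩, fun y' hy' ↦ ?_⟩
  simpa using hy'.naturality ⟨Y, f, g, h₁, h₂⟩ (𝟙 _) (𝟙 _) (by simp)

variable (ι₁) in
lemma existsUnique_left {X Z : A} (y : ι₂.obj Z ⟶ (ι₂.obj X)⟦(1 : ℤ)⟧) :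
    ∃! x, ExtRel ι₁ ι₂ x y := by
  obtain ⟨x, h, hx⟩ := existsUnique_right ι₁ y
  exact ⟨x, h.symm, fun x' h' ↦ hx _ h'.symm⟩

lemma comp {X X' Z Z' : A}
    {x : ι₁.obj Z ⟶ (ι₁.obj X)⟦(1 : ℤ)⟧} {y : ι₂.obj Z ⟶ (ι₂.obj X)⟦(1 : ℤ)⟧}
    (h : ExtRel ι₁ ι₂ x y) (v : Z' ⟶ Z) (u : X ⟶ X') :
    ExtRel ι₁ ι₂ (ι₁.map v ≫ x ≫ (ι₁.map u)⟦(1 : ℤ)⟧') (ι₂.map v ≫ y ≫ (ι₂.map u)⟦(1 : ℤ)⟧') := by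
  obtain ⟨z, hz, _⟩ := existsUnique_right ι₂ (x ≫ (ι₁.map u)⟦(1 : ℤ)⟧')
  obtain ⟨t, ht, _⟩ := existsUnique_right ι₂ (ι₁.map v ≫ x ≫ (ι₁.map u)⟦(1 : ℤ)⟧')
  have h₁ := h.naturality hz u (𝟙 _) (by simp)
  have h₂ := ht.naturality hz (𝟙 _) v (by simp)
  simp only [Functor.map_id, id_comp, comp_id] at h₁ h₂
  rwa [h₁, ← h₂]

end ExtRel

end ExtRel


/-! ### Shifting morphisms between shifted objects -/

section ShiftedMorphisms

variable {C : Type*} [Category* C] [HasShift C ℤ]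

/-- The morphism from `X⟦n⟧` to `Y⟦1 + n⟧` induced by a morphism `X ⟶ Y⟦1⟧`. -/
noncomputable def degreeOneShift {X Y : C} (e : X ⟶ Y⟦(1 : ℤ)⟧) (n n' : ℤ) (h : 1 + n = n') :
    X⟦n⟧ ⟶ Y⟦n'⟧ :=
  e⟦n⟧' ≫ (shiftFunctorAdd' C 1 n n' h).inv.app Y

/-- The morphism from `X⟦n + k⟧` to `Y⟦k⟧` induced by a morphism `X⟦n⟧ ⟶ Y`. -/
noncomputable def shiftedHomShift {X Y : C} {n : ℤ} (x : X⟦n⟧ ⟶ Y) (k n' : ℤ) (h : n + k = n') :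
    X⟦n'⟧ ⟶ Y⟦k⟧ :=
  (shiftFunctorAdd' C n k n' h).hom.app X ≫ x⟦k⟧'

lemma degreeOneShift_surjective {X Y : C} {n n' : ℤ} (x : X⟦n⟧ ⟶ Y⟦n'⟧) (h : 1 + n = n') :
    ∃ e : X ⟶ Y⟦(1 : ℤ)⟧, degreeOneShift e n n' h = x := by
  obtain ⟨e, he⟩ := (shiftFunctor C n).map_surjective
    (x ≫ (shiftFunctorAdd' C 1 n n' h).hom.app Y)
  exact ⟨e, by simp [degreeOneShift, he]⟩

lemma degreeOneShift_injective {X Y : C} {n n' : ℤ} {h : 1 + n = n'} {e e' : X ⟶ Y⟦(1 : ℤ)⟧}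
    (he : degreeOneShift e n n' h = degreeOneShift e' n n' h) : e = e' := by
  exact (shiftFunctor C n).map_injective (by simpa [degreeOneShift, cancel_mono] using he)

lemma comp_degreeOneShift {X X' Y : C} (e : X ⟶ Y⟦(1 : ℤ)⟧) (n n' : ℤ) (h : 1 + n = n')
    (u : X' ⟶ X) :
    u⟦n⟧' ≫ degreeOneShift e n n' h = degreeOneShift (u ≫ e) n n' h := by
  simp [degreeOneShift]

lemma degreeOneShift_comp {X Y Y' : C} (e : X ⟶ Y⟦(1 : ℤ)⟧) (n n' : ℤ) (h : 1 + n = n')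
    (v : Y ⟶ Y') :
    degreeOneShift e n n' h ≫ v⟦n'⟧' = degreeOneShift (e ≫ v⟦(1 : ℤ)⟧') n n' h := by
  have := (shiftFunctorAdd' C 1 n n' h).inv.naturality v
  dsimp at this
  simp [degreeOneShift, this]

lemma shiftedHomShift_surjective {X Y : C} {k n n' : ℤ} (x : X⟦n'⟧ ⟶ Y⟦k⟧) (h : n + k = n') :
    ∃ y : X⟦n⟧ ⟶ Y, shiftedHomShift y k n' h = x := by
  obtain ⟨y, hy⟩ := (shiftFunctor C k).map_surjective
    ((shiftFunctorAdd' C n k n' h).inv.app X ≫ x)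
  exact ⟨y, by simp [shiftedHomShift, hy]⟩

lemma shiftedHomShift_injective {X Y : C} {k n n' : ℤ} {h : n + k = n'} {x y : X⟦n⟧ ⟶ Y}
    (hxy : shiftedHomShift x k n' h = shiftedHomShift y k n' h) : x = y := by
  exact (shiftFunctor C k).map_injective (by simpa [shiftedHomShift, cancel_epi] using hxy)

lemma shiftedHomShift_comp {X Y Z : C} {n : ℤ} (x : X⟦n⟧ ⟶ Y) (f : Y ⟶ Z) (k n' : ℤ)
    (h : n + k = n') :
    shiftedHomShift x k n' h ≫ f⟦k⟧' = shiftedHomShift (x ≫ f) k n' h := by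
  simp [shiftedHomShift]

lemma comp_shiftedHomShift {X X' Y : C} {n : ℤ} (x : X⟦n⟧ ⟶ Y) (u : X' ⟶ X) (k n' : ℤ)
    (h : n + k = n') :
    u⟦n'⟧' ≫ shiftedHomShift x k n' h = shiftedHomShift (u⟦n⟧' ≫ x) k n' h := by
  simp [shiftedHomShift]

/-- This makes the shift of a matching compatible with the action of extension classes. -/
lemma degreeOneShift_shiftedHomShift {X Y Z : C} (e : X ⟶ Y⟦(1 : ℤ)⟧) {n m : ℤ} (hm : 1 + n = m)
    (x : Y⟦m⟧ ⟶ Z) (k n' m' : ℤ) (hn' : n + k = n') (hm' : m + k = m') (h : 1 + n' = m') :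
    degreeOneShift e n' m' h ≫ shiftedHomShift x k m' hm' =
      shiftedHomShift (degreeOneShift e n m hm ≫ x) k n' hn' := by
  have := shiftFunctorAdd'_assoc_hom_app 1 n k m n' m' hm hn' (by lia) Y
  have h₂ : (shiftFunctorAdd' C 1 n' m' h).inv.app Y ≫
      (shiftFunctorAdd' C m k m' hm').hom.app Y =
      (shiftFunctorAdd' C n k n' hn').hom.app (Y⟦(1 : ℤ)⟧) ≫
        ((shiftFunctorAdd' C 1 n m hm).inv.app Y)⟦k⟧' := by
    rw [← cancel_mono (((shiftFunctorAdd' C 1 n m hm).hom.app Y)⟦k⟧'), assoc, this, assoc,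
      ← Functor.map_comp]
    simp
  simp only [degreeOneShift, shiftedHomShift, assoc, Functor.map_comp]
  rw [reassoc_of% h₂]
  simp

lemma shiftedHomShift_add {X Y : C} {n : ℤ} (x : X⟦n⟧ ⟶ Y) (a b n' n'' : ℤ)
    (h : n + a = n') (h' : n' + b = n'') :
    shiftedHomShift x (a + b) n'' (by lia) ≫ (shiftFunctorAdd C a b).hom.app Y =
      shiftedHomShift (shiftedHomShift x a n' h) b n'' h' := by
  have := shiftFunctorAdd'_assoc_hom_app n a b n' (a + b) n'' h rfl (by lia) X
  simp only [shiftedHomShift, assoc, Functor.map_comp]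
  rw [reassoc_of% this, ← shiftFunctorAdd'_eq_shiftFunctorAdd]
  simp

lemma shiftedHomShift_zero {X Y : C} {n : ℤ} (x : X⟦n⟧ ⟶ Y) :
    shiftedHomShift x 0 n (by simp) ≫ (shiftFunctorZero C ℤ).hom.app Y = x := by
  simp [shiftedHomShift, shiftFunctorAdd'_add_zero_hom_app]

lemma shiftedHomShift_degreeOneShift_zero {X Y Z : C} (e : X ⟶ Y⟦(1 : ℤ)⟧)
    (x : Y⟦(0 : ℤ)⟧ ⟶ Z) :
    shiftedHomShift (degreeOneShift e (-1) 0 (by simp) ≫ x) 1 0 (by simp) =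
      (shiftFunctorZero C ℤ).hom.app X ≫ e ≫ ((shiftFunctorZero C ℤ).inv.app Y ≫ x)⟦(1 : ℤ)⟧' := by
  rw [← degreeOneShift_shiftedHomShift e (by simp) x 1 0 1 (by simp) (by simp) (by simp)]
  simp [degreeOneShift, shiftedHomShift, shiftFunctorAdd'_add_zero_inv_app,
    shiftFunctorAdd'_zero_add_hom_app]

end ShiftedMorphisms

section

variable {A T : Type*} [Category* A] [Abelian A] [Category* T] [HasZeroObject T] [HasShift T ℤ]
  [Preadditive T] [∀ n : ℤ, (shiftFunctor T n).Additive] [Pretriangulated T]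

lemma Functor.IsHereditaryEmbedding.hom_eq_zero (ι : A ⥤ T) [ι.IsHereditaryEmbedding] {X Y : A}
    {n k : ℤ} (h₀ : n ≠ k) (h₁ : 1 + n ≠ k) (f : (ι.obj X)⟦n⟧ ⟶ (ι.obj Y)⟦k⟧) : f = 0 := by
  obtain ⟨g, hg⟩ := (shiftFunctor T n).map_surjective
    (f ≫ (shiftFunctorAdd' T (k - n) n k (by simp)).hom.app (ι.obj Y))
  rw [← cancel_mono ((shiftFunctorAdd' T (k - n) n k (by simp)).hom.app (ι.obj Y)), ← hg,
    hom_shift_eq_zero (k - n) (by lia) (by lia) g]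
  simp

end

/-! ### Matchings between objects of the two triangulated categories -/

section Match

variable {A D T : Type*} [Category* A] [Abelian A]
  [Category* D] [HasZeroObject D] [HasShift D ℤ]
  [Preadditive D] [∀ n : ℤ, (shiftFunctor D n).Additive] [Pretriangulated D]
  [Category* T] [HasZeroObject T] [HasShift T ℤ]
  [Preadditive T] [∀ n : ℤ, (shiftFunctor T n).Additive] [Pretriangulated T]
  (ι₁ : A ⥤ D) (ι₂ : A ⥤ T)

/-- A matching of objects `X : D` and `M : T` consists of bijections between the types of
morphisms from `(ι₁ a)⟦n⟧` to `X` and from `(ι₂ a)⟦n⟧` to `M`, which are compatible with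
the action of the morphisms of degrees `0` and `1` between the objects of `A`. -/
structure Match (X : D) (M : T) where
  /-- the relation whose graph is the bijection -/
  rel {a : A} (n : ℤ) (x : (ι₁.obj a)⟦n⟧ ⟶ X) (y : (ι₂.obj a)⟦n⟧ ⟶ M) : Prop
  existsUnique_right {a : A} (n : ℤ) (x : (ι₁.obj a)⟦n⟧ ⟶ X) : ∃! y, rel n x y
  existsUnique_left {a : A} (n : ℤ) (y : (ι₂.obj a)⟦n⟧ ⟶ M) : ∃! x, rel n x y
  precomp {a b : A} (u : a ⟶ b) {n : ℤ} {x : (ι₁.obj b)⟦n⟧ ⟶ X} {y : (ι₂.obj b)⟦n⟧ ⟶ M}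
    (h : rel n x y) : rel n ((ι₁.map u)⟦n⟧' ≫ x) ((ι₂.map u)⟦n⟧' ≫ y)
  precompExt {a b : A} {e : ι₁.obj a ⟶ (ι₁.obj b)⟦(1 : ℤ)⟧} {e' : ι₂.obj a ⟶ (ι₂.obj b)⟦(1 : ℤ)⟧}
    (he : ExtRel ι₁ ι₂ e e') {n n' : ℤ} (hn : 1 + n = n')
    {x : (ι₁.obj b)⟦n'⟧ ⟶ X} {y : (ι₂.obj b)⟦n'⟧ ⟶ M} (h : rel n' x y) :
    rel n (degreeOneShift e n n' hn ≫ x) (degreeOneShift e' n n' hn ≫ y)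

namespace Match

variable {ι₁ ι₂}

section

variable {X : D} {M : T} (m : Match ι₁ ι₂ X M)

lemma eq_right {a : A} {n : ℤ} {x : (ι₁.obj a)⟦n⟧ ⟶ X} {y y' : (ι₂.obj a)⟦n⟧ ⟶ M}
    (h : m.rel n x y) (h' : m.rel n x y') : y = y' :=
  (m.existsUnique_right n x).unique h h'

lemma eq_left {a : A} {n : ℤ} {x x' : (ι₁.obj a)⟦n⟧ ⟶ X} {y : (ι₂.obj a)⟦n⟧ ⟶ M}
    (h : m.rel n x y) (h' : m.rel n x' y) : x = x' :=
  (m.existsUnique_left n y).unique h h'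

variable [ι₁.Additive] [ι₂.Additive]

lemma rel_zero {a : A} (n : ℤ) : m.rel n (0 : (ι₁.obj a)⟦n⟧ ⟶ X) 0 := by
  obtain ⟨y, hy, _⟩ := m.existsUnique_right n (0 : (ι₁.obj a)⟦n⟧ ⟶ X)
  simpa using m.precomp (0 : a ⟶ a) hy

/-- Additivity need not be required in `Match`: the pair `(x, x')` is one morphism from `a ⊞ a`, and
`x + x'` is its composite with the diagonal of `a`. -/
lemma rel_add {a : A} {n : ℤ} {x x' : (ι₁.obj a)⟦n⟧ ⟶ X} {y y' : (ι₂.obj a)⟦n⟧ ⟶ M}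
    (h : m.rel n x y) (h' : m.rel n x' y') : m.rel n (x + x') (y + y') := by
  let z : (ι₁.obj (a ⊞ a))⟦n⟧ ⟶ X :=
    (ι₁.map biprod.fst)⟦n⟧' ≫ x + (ι₁.map biprod.snd)⟦n⟧' ≫ x'
  obtain ⟨w, hw, _⟩ := m.existsUnique_right n z
  have hz₁ : (ι₁.map (biprod.inl : a ⟶ a ⊞ a))⟦n⟧' ≫ z = x := by
    rw [comp_add, ← Functor.map_comp_assoc, ← Functor.map_comp_assoc, ← ι₁.map_comp,
      ← ι₁.map_comp]
    simp
  have hz₂ : (ι₁.map (biprod.inr : a ⟶ a ⊞ a))⟦n⟧' ≫ z = x' := by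
    rw [comp_add, ← Functor.map_comp_assoc, ← Functor.map_comp_assoc, ← ι₁.map_comp,
      ← ι₁.map_comp]
    simp
  have h₁ := m.precomp biprod.inl hw
  have h₂ := m.precomp biprod.inr hw
  rw [hz₁] at h₁
  rw [hz₂] at h₂
  have h₃ := m.precomp (biprod.inl + biprod.inr) hw
  rw [m.eq_right h h₁, m.eq_right h' h₂, ← hz₁, ← hz₂]
  simpa only [Functor.map_add, add_comp, hz₁, hz₂] using h₃

end

/-- The compatibility of morphisms `f : X ⟶ X'` and `g : M ⟶ M'` with matchings. -/
def Compat {X X' : D} {M M' : T} (m : Match ι₁ ι₂ X M) (m' : Match ι₁ ι₂ X' M')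
    (f : X ⟶ X') (g : M ⟶ M') : Prop :=
  ∀ ⦃a : A⦄ ⦃n : ℤ⦄ ⦃x : (ι₁.obj a)⟦n⟧ ⟶ X⦄ ⦃y : (ι₂.obj a)⟦n⟧ ⟶ M⦄, m.rel n x y →
    m'.rel n (x ≫ f) (y ≫ g)

lemma Compat.id {X : D} {M : T} (m : Match ι₁ ι₂ X M) : m.Compat m (𝟙 X) (𝟙 M) :=
  fun _ _ _ _ h ↦ by simpa using h

lemma Compat.comp {X X' X'' : D} {M M' M'' : T} {m : Match ι₁ ι₂ X M} {m' : Match ι₁ ι₂ X' M'}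
    {m'' : Match ι₁ ι₂ X'' M''} {f : X ⟶ X'} {g : M ⟶ M'} {f' : X' ⟶ X''} {g' : M' ⟶ M''}
    (h : m.Compat m' f g) (h' : m'.Compat m'' f' g') : m.Compat m'' (f ≫ f') (g ≫ g') :=
  fun _ _ _ _ hxy ↦ by simpa using h' (h hxy)

lemma Compat.add [ι₁.Additive] [ι₂.Additive] {X X' : D} {M M' : T} {m : Match ι₁ ι₂ X M}
    {m' : Match ι₁ ι₂ X' M'} {f f' : X ⟶ X'} {g g' : M ⟶ M'}
    (h : m.Compat m' f g) (h' : m.Compat m' f' g') : m.Compat m' (f + f') (g + g') :=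
  fun _ _ _ _ hxy ↦ by simpa using m'.rel_add (h hxy) (h' hxy)

/-- A matching is rigid if any morphism from one of the objects is compatible with a unique
morphism from the other object. -/
structure Rigid {X : D} {M : T} (m : Match ι₁ ι₂ X M) : Prop where
  existsUnique_right {X' : D} {M' : T} (m' : Match ι₁ ι₂ X' M') (f : X ⟶ X') :
    ∃! g : M ⟶ M', m.Compat m' f g
  existsUnique_left {X' : D} {M' : T} (m' : Match ι₁ ι₂ X' M') (g : M ⟶ M') :
    ∃! f : X ⟶ X', m.Compat m' f g

/-- The matching of shifted objects. -/
def shift {X : D} {M : T} (m : Match ι₁ ι₂ X M) (k : ℤ) : Match ι₁ ι₂ (X⟦k⟧) (M⟦k⟧) where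
  rel n x y := ∃ (n' : ℤ) (h : n' + k = n) (x' : _ ⟶ X) (y' : _ ⟶ M), m.rel n' x' y' ∧
    shiftedHomShift x' k n h = x ∧ shiftedHomShift y' k n h = y
  existsUnique_right {a} n x := by
    obtain ⟨x', rfl⟩ := shiftedHomShift_surjective x (show (n - k) + k = n by simp)
    obtain ⟨y', hy, hy'⟩ := m.existsUnique_right _ x'
    refine ⟨shiftedHomShift y' k n (by simp), ⟨_, _, x', y', hy, rfl, rfl⟩, ?_⟩
    rintro _ ⟨n', h, x'', y'', h', hx, rfl⟩
    obtain rfl : n' = n - k := by lia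
    obtain rfl := shiftedHomShift_injective hx
    rw [hy' _ h']
  existsUnique_left {a} n y := by
    obtain ⟨y', rfl⟩ := shiftedHomShift_surjective y (show (n - k) + k = n by simp)
    obtain ⟨x', hx, hx'⟩ := m.existsUnique_left _ y'
    refine ⟨shiftedHomShift x' k n (by simp), ⟨_, _, x', y', hx, rfl, rfl⟩, ?_⟩
    rintro _ ⟨n', h, x'', y'', h', rfl, hy⟩
    obtain rfl : n' = n - k := by lia
    obtain rfl := shiftedHomShift_injective hy
    rw [hx' _ h']
  precomp u n x y := by
    rintro ⟨n', h, x', y', h', rfl, rfl⟩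
    exact ⟨n', h, _, _, m.precomp u h', by simp [comp_shiftedHomShift],
      by simp [comp_shiftedHomShift]⟩
  precompExt {a b e e'} he n n' hn x y := by
    rintro ⟨l, hl, x', y', h', rfl, rfl⟩
    refine ⟨l - 1, by lia, _, _, m.precompExt he (by lia) h', ?_, ?_⟩
    · rw [degreeOneShift_shiftedHomShift]
    · rw [degreeOneShift_shiftedHomShift]

lemma shift_rel {X : D} {M : T} (m : Match ι₁ ι₂ X M) {a : A} {n : ℤ} {x : (ι₁.obj a)⟦n⟧ ⟶ X}
    {y : (ι₂.obj a)⟦n⟧ ⟶ M} (h : m.rel n x y) (k n' : ℤ) (hn' : n + k = n') :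
    (m.shift k).rel n' (shiftedHomShift x k n' hn') (shiftedHomShift y k n' hn') :=
  ⟨n, hn', x, y, h, rfl, rfl⟩

lemma Compat.shift {X X' : D} {M M' : T} {m : Match ι₁ ι₂ X M} {m' : Match ι₁ ι₂ X' M'}
    {f : X ⟶ X'} {g : M ⟶ M'} (h : m.Compat m' f g) (k : ℤ) :
    (m.shift k).Compat (m'.shift k) (f⟦k⟧') (g⟦k⟧') := by
  rintro a n _ _ ⟨n', hn', x, y, hxy, rfl, rfl⟩
  rw [shiftedHomShift_comp, shiftedHomShift_comp]
  exact shift_rel _ (h hxy) _ _ _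

lemma compat_shiftFunctorAdd_inv {X : D} {M : T} (m : Match ι₁ ι₂ X M) (a b : ℤ) :
    ((m.shift a).shift b).Compat (m.shift (a + b)) ((shiftFunctorAdd D a b).inv.app X)
      ((shiftFunctorAdd T a b).inv.app M) := by
  rintro c n _ _ ⟨n', hn', _, _, ⟨n'', hn'', x, y, h, rfl, rfl⟩, rfl, rfl⟩
  refine ⟨n'', by lia, x, y, h, ?_, ?_⟩
  · rw [← shiftedHomShift_add, assoc, Iso.hom_inv_id_app, comp_id]
  · rw [← shiftedHomShift_add, assoc, Iso.hom_inv_id_app, comp_id]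

lemma compat_shiftFunctorZero_inv {X : D} {M : T} (m : Match ι₁ ι₂ X M) :
    m.Compat (m.shift 0) ((shiftFunctorZero D ℤ).inv.app X)
      ((shiftFunctorZero T ℤ).inv.app M) := by
  rintro c n x y h
  refine ⟨n, by simp, x, y, h, ?_, ?_⟩
  · rw [← cancel_mono ((shiftFunctorZero D ℤ).hom.app X), shiftedHomShift_zero, assoc,
      Iso.inv_hom_id_app]
    exact (comp_id _).symm
  · rw [← cancel_mono ((shiftFunctorZero T ℤ).hom.app M), shiftedHomShift_zero, assoc,
      Iso.inv_hom_id_app]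
    exact (comp_id _).symm

/-- The transport of a matching along isomorphisms. -/
@[simps]
def ofIso {X X' : D} {M M' : T} (m : Match ι₁ ι₂ X M) (e : X' ≅ X) (e' : M' ≅ M) :
    Match ι₁ ι₂ X' M' where
  rel n x y := m.rel n (x ≫ e.hom) (y ≫ e'.hom)
  existsUnique_right n x := by
    obtain ⟨y, hy, hy'⟩ := m.existsUnique_right n (x ≫ e.hom)
    exact ⟨y ≫ e'.inv, by simpa using hy, fun z hz ↦ by simp [← hy' _ hz]⟩
  existsUnique_left n y := by
    obtain ⟨x, hx, hx'⟩ := m.existsUnique_left n (y ≫ e'.hom)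
    exact ⟨x ≫ e.inv, by simpa using hx, fun z hz ↦ by simp [← hx' _ hz]⟩
  precomp u n x y h := by simpa using m.precomp u h
  precompExt he n n' hn x y h := by simpa using m.precompExt he hn h

lemma compat_ofIso_hom {X X' : D} {M M' : T} (m : Match ι₁ ι₂ X M) (e : X' ≅ X) (e' : M' ≅ M) :
    (m.ofIso e e').Compat m e.hom e'.hom :=
  fun _ _ _ _ h ↦ h

lemma compat_ofIso_inv {X X' : D} {M M' : T} (m : Match ι₁ ι₂ X M) (e : X' ≅ X) (e' : M' ≅ M) :
    m.Compat (m.ofIso e e') e.inv e'.inv :=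
  fun _ _ _ _ h ↦ by simpa using h

lemma Rigid.ofIso {X X' : D} {M M' : T} {m : Match ι₁ ι₂ X M} (hm : m.Rigid) (e : X' ≅ X)
    (e' : M' ≅ M) : (m.ofIso e e').Rigid where
  existsUnique_right m' f := by
    obtain ⟨g, hg, hg'⟩ := hm.existsUnique_right m' (e.inv ≫ f)
    refine ⟨e'.hom ≫ g, by simpa using (m.compat_ofIso_hom e e').comp hg, fun g' h ↦ ?_⟩
    simp [← hg' _ ((m.compat_ofIso_inv e e').comp h)]
  existsUnique_left m' g := by
    obtain ⟨f, hf, hf'⟩ := hm.existsUnique_left m' (e'.inv ≫ g)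
    refine ⟨e.hom ≫ f, by simpa using (m.compat_ofIso_hom e e').comp hf, fun f' h ↦ ?_⟩
    simp [← hf' _ ((m.compat_ofIso_inv e e').comp h)]

/-- The matching of zero objects. -/
def ofIsZero {X : D} {M : T} (hX : IsZero X) (hM : IsZero M) : Match ι₁ ι₂ X M where
  rel _ _ _ := True
  existsUnique_right _ _ := ⟨0, trivial, fun _ _ ↦ hM.eq_of_tgt _ _⟩
  existsUnique_left _ _ := ⟨0, trivial, fun _ _ ↦ hX.eq_of_tgt _ _⟩
  precomp _ _ _ _ _ := trivial
  precompExt _ _ _ _ _ _ _ := trivial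

section

variable [ι₁.Additive] [ι₂.Additive]

lemma rigid_ofIsZero {X : D} {M : T} (hX : IsZero X) (hM : IsZero M) :
    (ofIsZero (ι₁ := ι₁) (ι₂ := ι₂) hX hM).Rigid where
  existsUnique_right m' f := ⟨0, fun a n x y _ ↦ by
    simpa [hX.eq_of_tgt x 0] using m'.rel_zero n, fun _ _ ↦ hM.eq_of_src _ _⟩
  existsUnique_left m' g := ⟨0, fun a n x y _ ↦ by
    simpa [hM.eq_of_tgt y 0] using m'.rel_zero n, fun _ _ ↦ hX.eq_of_src _ _⟩

/-- The matching of direct sums. -/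
noncomputable def biprod {X X' : D} {M M' : T} (m : Match ι₁ ι₂ X M) (m' : Match ι₁ ι₂ X' M') :
    Match ι₁ ι₂ (X ⊞ X') (M ⊞ M') where
  rel n x y := m.rel n (x ≫ biprod.fst) (y ≫ biprod.fst) ∧
    m'.rel n (x ≫ biprod.snd) (y ≫ biprod.snd)
  existsUnique_right n x := by
    obtain ⟨y, hy, hy'⟩ := m.existsUnique_right n (x ≫ biprod.fst)
    obtain ⟨z, hz, hz'⟩ := m'.existsUnique_right n (x ≫ biprod.snd)
    refine ⟨biprod.lift y z, by simp [hy, hz], fun t ht ↦ ?_⟩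
    apply biprod.hom_ext
    · simpa using hy' _ ht.1
    · simpa using hz' _ ht.2
  existsUnique_left n x := by
    obtain ⟨y, hy, hy'⟩ := m.existsUnique_left n (x ≫ biprod.fst)
    obtain ⟨z, hz, hz'⟩ := m'.existsUnique_left n (x ≫ biprod.snd)
    refine ⟨biprod.lift y z, by simp [hy, hz], fun t ht ↦ ?_⟩
    apply biprod.hom_ext
    · simpa using hy' _ ht.1
    · simpa using hz' _ ht.2
  precomp u n x y h := by simpa using ⟨m.precomp u h.1, m'.precomp u h.2⟩
  precompExt he n n' hn x y h := by simpa using ⟨m.precompExt he hn h.1, m'.precompExt he hn h.2⟩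

lemma compat_inl {X X' : D} {M M' : T} (m : Match ι₁ ι₂ X M) (m' : Match ι₁ ι₂ X' M') :
    m.Compat (m.biprod m') biprod.inl biprod.inl :=
  fun _ n _ _ h ↦ ⟨by simpa using h, by simpa using m'.rel_zero n⟩

lemma compat_inr {X X' : D} {M M' : T} (m : Match ι₁ ι₂ X M) (m' : Match ι₁ ι₂ X' M') :
    m'.Compat (m.biprod m') biprod.inr biprod.inr :=
  fun _ n _ _ h ↦ ⟨by simpa using m.rel_zero n, by simpa using h⟩

lemma compat_desc {X X' X'' : D} {M M' M'' : T} {m : Match ι₁ ι₂ X M} {m' : Match ι₁ ι₂ X' M'}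
    {m'' : Match ι₁ ι₂ X'' M''} {f : X ⟶ X''} {g : M ⟶ M''} {f' : X' ⟶ X''} {g' : M' ⟶ M''}
    (h : m.Compat m'' f g) (h' : m'.Compat m'' f' g') :
    (m.biprod m').Compat m'' (biprod.desc f f') (biprod.desc g g') := fun _ _ _ _ hxy ↦ by
  simpa [biprod.desc_eq] using m''.rel_add (h hxy.1) (h' hxy.2)

lemma Rigid.biprod {X X' : D} {M M' : T} {m : Match ι₁ ι₂ X M} {m' : Match ι₁ ι₂ X' M'}
    (hm : m.Rigid) (hm' : m'.Rigid) : (m.biprod m').Rigid where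
  existsUnique_right m'' f := by
    obtain ⟨g, hg, hgu⟩ := hm.existsUnique_right m'' (biprod.inl ≫ f)
    obtain ⟨g', hg', hgu'⟩ := hm'.existsUnique_right m'' (biprod.inr ≫ f)
    refine ⟨biprod.desc g g', ?_, fun t ht ↦ ?_⟩
    · convert compat_desc hg hg' using 1
      cat_disch
    · rw [← hgu _ ((compat_inl m m').comp ht), ← hgu' _ ((compat_inr m m').comp ht)]
      cat_disch
  existsUnique_left m'' f := by
    obtain ⟨g, hg, hgu⟩ := hm.existsUnique_left m'' (biprod.inl ≫ f)
    obtain ⟨g', hg', hgu'⟩ := hm'.existsUnique_left m'' (biprod.inr ≫ f)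
    refine ⟨biprod.desc g g', ?_, fun t ht ↦ ?_⟩
    · convert compat_desc hg hg' using 1
      cat_disch
    · rw [← hgu _ ((compat_inl m m').comp ht), ← hgu' _ ((compat_inr m m').comp ht)]
      cat_disch

end

section Base

variable [ι₁.IsHereditaryEmbedding] [ι₂.IsHereditaryEmbedding]

variable (ι₁ ι₂) in
/-- The relation between morphisms `(ι₁ a)⟦n⟧ ⟶ (ι₁ b)⟦k⟧` and `(ι₂ a)⟦n⟧ ⟶ (ι₂ b)⟦k⟧` coming
from the morphisms and the extensions in `A`. -/
def BaseRel {a b : A} (n k : ℤ) (x : (ι₁.obj a)⟦n⟧ ⟶ (ι₁.obj b)⟦k⟧)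
    (y : (ι₂.obj a)⟦n⟧ ⟶ (ι₂.obj b)⟦k⟧) : Prop :=
  (∀ h : n = k, ∃ u : a ⟶ b, x = (ι₁.map u)⟦n⟧' ≫ eqToHom (by rw [h]) ∧
    y = (ι₂.map u)⟦n⟧' ≫ eqToHom (by rw [h])) ∧
  (∀ h : 1 + n = k, ∃ (e : ι₁.obj a ⟶ (ι₁.obj b)⟦(1 : ℤ)⟧) (e' : ι₂.obj a ⟶ (ι₂.obj b)⟦(1 : ℤ)⟧),
    ExtRel ι₁ ι₂ e e' ∧ x = degreeOneShift e n k h ∧ y = degreeOneShift e' n k h)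

namespace BaseRel

omit [ι₁.IsHereditaryEmbedding] [ι₂.IsHereditaryEmbedding] in
lemma symm {a b : A} {n k : ℤ} {x : (ι₁.obj a)⟦n⟧ ⟶ (ι₁.obj b)⟦k⟧}
    {y : (ι₂.obj a)⟦n⟧ ⟶ (ι₂.obj b)⟦k⟧} (h : BaseRel ι₁ ι₂ n k x y) : BaseRel ι₂ ι₁ n k y x := by
  refine ⟨fun hn ↦ ?_, fun hn ↦ ?_⟩
  · obtain ⟨u, hx, hy⟩ := h.1 hn
    exact ⟨u, hy, hx⟩
  · obtain ⟨e, e', he, hx, hy⟩ := h.2 hn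
    exact ⟨e', e, he.symm, hy, hx⟩

lemma existsUnique_right {a b : A} (n k : ℤ) (x : (ι₁.obj a)⟦n⟧ ⟶ (ι₁.obj b)⟦k⟧) :
    ∃! y, BaseRel ι₁ ι₂ n k x y := by
  by_cases h₀ : n = k
  · subst h₀
    obtain ⟨x, rfl⟩ := (shiftFunctor D n).map_surjective x
    obtain ⟨u, rfl⟩ := ι₁.map_surjective x
    refine ⟨(ι₂.map u)⟦n⟧', ⟨fun _ ↦ ⟨u, by simp, by simp⟩, fun h ↦ by lia⟩, fun y hy ↦ ?_⟩
    obtain ⟨v, hx, rfl⟩ := hy.1 rfl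
    simp only [eqToHom_refl, comp_id] at hx
    obtain rfl := ι₁.map_injective ((shiftFunctor D n).map_injective hx)
    simp
  · by_cases h₁ : 1 + n = k
    · obtain ⟨e, rfl⟩ := degreeOneShift_surjective x h₁
      obtain ⟨e', he, he'⟩ := ExtRel.existsUnique_right ι₂ e
      refine ⟨degreeOneShift e' n k h₁, ⟨fun h ↦ (h₀ h).elim, fun _ ↦ ⟨e, e', he, rfl, rfl⟩⟩,
        fun y hy ↦ ?_⟩
      obtain ⟨e₁, e₁', he₁, hx, rfl⟩ := hy.2 h₁
      obtain rfl := degreeOneShift_injective hx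
      rw [he' _ he₁]
    · exact ⟨0, ⟨fun h ↦ (h₀ h).elim, fun h ↦ (h₁ h).elim⟩, fun y _ ↦
        Functor.IsHereditaryEmbedding.hom_eq_zero ι₂ h₀ h₁ y⟩

lemma precomp {a b c : A} (u : a ⟶ b) {n k : ℤ} {x : (ι₁.obj b)⟦n⟧ ⟶ (ι₁.obj c)⟦k⟧}
    {y : (ι₂.obj b)⟦n⟧ ⟶ (ι₂.obj c)⟦k⟧} (h : BaseRel ι₁ ι₂ n k x y) :
    BaseRel ι₁ ι₂ n k ((ι₁.map u)⟦n⟧' ≫ x) ((ι₂.map u)⟦n⟧' ≫ y) := by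
  refine ⟨fun hn ↦ ?_, fun hn ↦ ?_⟩
  · obtain ⟨v, rfl, rfl⟩ := h.1 hn
    exact ⟨u ≫ v, by simp, by simp⟩
  · obtain ⟨e, e', he, rfl, rfl⟩ := h.2 hn
    refine ⟨_, _, he.comp u (𝟙 _), ?_, ?_⟩ <;> simp [comp_degreeOneShift]

/-- Only `x` and `y` of degree 0 matter. In degree 1 the composite has degree 2, where `BaseRel`
imposes no condition; in degree -1 both are zero. -/
lemma precompExt {a b c : A} {e : ι₁.obj a ⟶ (ι₁.obj b)⟦(1 : ℤ)⟧}
    {e' : ι₂.obj a ⟶ (ι₂.obj b)⟦(1 : ℤ)⟧} (he : ExtRel ι₁ ι₂ e e') {n n' k : ℤ} (hn : 1 + n = n')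
    {x : (ι₁.obj b)⟦n'⟧ ⟶ (ι₁.obj c)⟦k⟧} {y : (ι₂.obj b)⟦n'⟧ ⟶ (ι₂.obj c)⟦k⟧}
    (h : BaseRel ι₁ ι₂ n' k x y) :
    BaseRel ι₁ ι₂ n k (degreeOneShift e n n' hn ≫ x) (degreeOneShift e' n n' hn ≫ y) := by
  refine ⟨fun hk ↦ ⟨0, ?_, ?_⟩, fun hk ↦ ?_⟩
  · rw [Functor.IsHereditaryEmbedding.hom_eq_zero ι₁ (by lia) (by lia) x]
    simp
  · rw [Functor.IsHereditaryEmbedding.hom_eq_zero ι₂ (by lia) (by lia) y]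
    simp
  · obtain rfl : n' = k := by lia
    obtain ⟨u, rfl, rfl⟩ := h.1 rfl
    refine ⟨_, _, he.comp (𝟙 _) u, ?_, ?_⟩ <;> simp [degreeOneShift_comp]

/-- In degrees 0 and 1 this is the compatibility built into `Match`; in the other degrees `x` and
`y` vanish. Together with `BaseRel.id` it gives the Yoneda argument of `rigid_base`: a morphism out
of `(ι₁.obj b)⟦k⟧` is itself an element that can be matched. -/
lemma comp_rel {a b : A} {n k : ℤ} {x : (ι₁.obj a)⟦n⟧ ⟶ (ι₁.obj b)⟦k⟧}
    {y : (ι₂.obj a)⟦n⟧ ⟶ (ι₂.obj b)⟦k⟧} (h : BaseRel ι₁ ι₂ n k x y) {X : D} {M : T}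
    (m : Match ι₁ ι₂ X M) {f : (ι₁.obj b)⟦k⟧ ⟶ X} {g : (ι₂.obj b)⟦k⟧ ⟶ M} (hfg : m.rel k f g) :
    m.rel n (x ≫ f) (y ≫ g) := by
  by_cases h₀ : n = k
  · subst h₀
    obtain ⟨u, rfl, rfl⟩ := h.1 rfl
    simpa using m.precomp u hfg
  · by_cases h₁ : 1 + n = k
    · obtain ⟨e, e', he, rfl, rfl⟩ := h.2 h₁
      exact m.precompExt he h₁ hfg
    · rw [Functor.IsHereditaryEmbedding.hom_eq_zero ι₁ h₀ h₁ x,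
        Functor.IsHereditaryEmbedding.hom_eq_zero ι₂ h₀ h₁ y, zero_comp, zero_comp]
      exact m.rel_zero n

omit [ι₁.IsHereditaryEmbedding] [ι₂.IsHereditaryEmbedding] in
lemma id (a : A) (n : ℤ) : BaseRel ι₁ ι₂ n n (𝟙 ((ι₁.obj a)⟦n⟧)) (𝟙 ((ι₂.obj a)⟦n⟧)) :=
  ⟨fun _ ↦ ⟨𝟙 a, by simp, by simp⟩, fun h ↦ by lia⟩

end BaseRel

variable (ι₁ ι₂) in
/-- The matching of the shifts of the images of an object of `A`. -/
def base (b : A) (k : ℤ) : Match ι₁ ι₂ ((ι₁.obj b)⟦k⟧) ((ι₂.obj b)⟦k⟧) where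
  rel n x y := BaseRel ι₁ ι₂ n k x y
  existsUnique_right n x := BaseRel.existsUnique_right n k x
  existsUnique_left n y := by
    obtain ⟨x, hx, hx'⟩ := BaseRel.existsUnique_right (ι₁ := ι₂) (ι₂ := ι₁) n k y
    exact ⟨x, hx.symm, fun x' h ↦ hx' _ h.symm⟩
  precomp u _ _ _ h := h.precomp u
  precompExt he _ _ hn _ _ h := h.precompExt he hn

lemma rigid_base (b : A) (k : ℤ) : (base ι₁ ι₂ b k).Rigid where
  existsUnique_right m' f := by
    obtain ⟨g, hg, hg'⟩ := m'.existsUnique_right k f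
    exact ⟨g, fun _ _ _ _ h ↦ BaseRel.comp_rel h m' hg,
      fun g' h ↦ hg' g' (by simpa using h (BaseRel.id b k))⟩
  existsUnique_left m' g := by
    obtain ⟨f, hf, hf'⟩ := m'.existsUnique_left k g
    exact ⟨f, fun _ _ _ _ h ↦ BaseRel.comp_rel h m' hf,
      fun f' h ↦ hf' f' (by simpa using h (BaseRel.id b k))⟩

end Base

end Match

end Match


/-! ### Finite direct sums of shifts of objects of `A` -/

section SumShifts

variable {A T : Type*} [Category* A] [Abelian A] [Category* T] [HasZeroObject T] [HasShift T ℤ]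
  [Preadditive T] [∀ n : ℤ, (shiftFunctor T n).Additive] [Pretriangulated T]

/-- The finite direct sums of shifts `(ι a)⟦i⟧` with `i` in a given set of integers. -/
inductive SumShifts (ι : A ⥤ T) (I : Set ℤ) : ObjectProperty T
  | zero {X : T} (hX : IsZero X) : SumShifts ι I X
  | add {X Y : T} (a : A) (i : ℤ) (hi : i ∈ I) (hY : SumShifts ι I Y)
      (e : X ≅ (ι.obj a)⟦i⟧ ⊞ Y) : SumShifts ι I X

attribute [local instance] preservesBinaryBiproducts_of_preservesBiproducts

namespace SumShifts

/-- The isomorphism between binary direct sums which exchanges the first two out of three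
summands. -/
noncomputable def biprodLeftComm (X Y Z : T) : X ⊞ (Y ⊞ Z) ≅ Y ⊞ (X ⊞ Z) where
  hom := biprod.desc (biprod.inl ≫ biprod.inr)
    (biprod.desc biprod.inl (biprod.inr ≫ biprod.inr))
  inv := biprod.desc (biprod.inl ≫ biprod.inr)
    (biprod.desc biprod.inl (biprod.inr ≫ biprod.inr))

/-- The associativity of binary direct sums. -/
noncomputable def biprodAssoc (X Y Z : T) : X ⊞ (Y ⊞ Z) ≅ (X ⊞ Y) ⊞ Z where
  hom := biprod.desc (biprod.inl ≫ biprod.inl)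
    (biprod.desc (biprod.inr ≫ biprod.inl) biprod.inr)
  inv := biprod.desc (biprod.desc biprod.inl (biprod.inl ≫ biprod.inr))
    (biprod.inr ≫ biprod.inr)

variable {ι : A ⥤ T} {I J : Set ℤ}

lemma of_iso {X X' : T} (h : SumShifts ι I X) (e : X' ≅ X) : SumShifts ι I X' := by
  cases h with
  | zero hX => exact .zero (hX.of_iso e)
  | add a i hi hY e' => exact .add a i hi hY (e ≪≫ e')

lemma mono (hIJ : I ⊆ J) {X : T} (h : SumShifts ι I X) : SumShifts ι J X := by
  induction h with
  | zero hX => exact .zero hX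
  | add a i hi _ e ih => exact .add a i (hIJ hi) ih e

lemma single (a : A) {i : ℤ} (hi : i ∈ I) : SumShifts ι I ((ι.obj a)⟦i⟧) :=
  .add a i hi (.zero (isZero_zero T)) (isoBiprodZero (isZero_zero T))

lemma biprod {X Y : T} (hX : SumShifts ι I X) (hY : SumShifts ι I Y) :
    SumShifts ι I (X ⊞ Y) := by
  induction hX with
  | zero hX => exact hY.of_iso (isoZeroBiprod hX).symm
  | add a i hi _ e ih =>
    exact .add a i hi ih (biprod.mapIso e (Iso.refl _) ≪≫ (biprodAssoc _ _ _).symm)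

lemma shift {X : T} (hX : SumShifts ι I X) (k : ℤ) (hk : ∀ i ∈ I, i + k ∈ J) :
    SumShifts ι J (X⟦k⟧) := by
  induction hX with
  | zero hX => exact .zero ((shiftFunctor T k).map_isZero hX)
  | add a i hi _ e ih =>
    exact .add a (i + k) (hk i hi) ih ((shiftFunctor T k).mapIso e ≪≫
      (shiftFunctor T k).mapBiprod _ _ ≪≫
        biprod.mapIso ((shiftFunctorAdd T i k).symm.app _) (Iso.refl _))

lemma exists_iso_biprod {X : T} (hX : SumShifts ι I X) (J : Set ℤ) :
    ∃ (X₁ X₂ : T), SumShifts ι (I ∩ J) X₁ ∧ SumShifts ι (I \ J) X₂ ∧ Nonempty (X ≅ X₁ ⊞ X₂) := by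
  induction hX with
  | zero hX => exact ⟨0, 0, .zero (isZero_zero T), .zero (isZero_zero T),
      ⟨hX.iso (isZero_zero T) ≪≫ isoBiprodZero (isZero_zero T)⟩⟩
  | add a i hi _ e ih =>
    obtain ⟨X₁, X₂, h₁, h₂, ⟨e'⟩⟩ := ih
    by_cases h : i ∈ J
    · exact ⟨_, X₂, .add a i ⟨hi, h⟩ h₁ (Iso.refl _), h₂,
        ⟨e ≪≫ biprod.mapIso (Iso.refl _) e' ≪≫ biprodAssoc _ _ _⟩⟩
    · exact ⟨X₁, _, h₁, .add a i ⟨hi, h⟩ h₂ (Iso.refl _),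
        ⟨e ≪≫ biprod.mapIso (Iso.refl _) e' ≪≫ biprodLeftComm _ _ _⟩⟩

lemma exists_bounds {X : T} (hX : SumShifts ι I X) :
    ∃ (n : ℤ) (N : ℕ), SumShifts ι (Set.Ico n (n + N)) X := by
  induction hX with
  | zero hX => exact ⟨0, 0, .zero hX⟩
  | add a i hi _ e ih =>
    obtain ⟨n, N, h⟩ := ih
    refine ⟨min n i, N + (n - i).natAbs + 1, .add a i ?_ (h.mono ?_) e⟩
    · simp only [Set.mem_Ico]
      lia
    · intro j hj
      simp only [Set.mem_Ico] at hj ⊢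
      lia

lemma exists_iso_single [ι.Additive] {X : T} {i : ℤ} (hX : SumShifts ι {i} X) :
    ∃ a : A, Nonempty (X ≅ (ι.obj a)⟦i⟧) := by
  induction hX with
  | zero hX => exact ⟨0, ⟨hX.iso ((ι ⋙ shiftFunctor T i).map_isZero (isZero_zero A))⟩⟩
  | add a j hj _ e ih =>
    obtain rfl : j = i := hj
    obtain ⟨b, ⟨e'⟩⟩ := ih
    exact ⟨a ⊞ b, ⟨e ≪≫ biprod.mapIso (Iso.refl _) e' ≪≫
      ((ι ⋙ shiftFunctor T j).mapBiprod _ _).symm⟩⟩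

lemma hom_eq_zero [ι.IsHereditaryEmbedding] {X Y : T} (hX : SumShifts ι I X)
    (hY : SumShifts ι J Y) (h : ∀ i ∈ I, ∀ j ∈ J, i ≠ j ∧ 1 + i ≠ j) (f : X ⟶ Y) : f = 0 := by
  induction hX with
  | zero hX => exact hX.eq_of_src _ _
  | add a i hi _ e ih =>
    rw [← cancel_epi e.inv, comp_zero]
    apply biprod.hom_ext'
    · rw [comp_zero]
      generalize biprod.inl ≫ e.inv ≫ f = g
      clear ih f e
      induction hY with
      | zero hY => exact hY.eq_of_tgt _ _
      | add b j hj _ e ih =>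
        rw [← cancel_mono e.hom, zero_comp]
        apply biprod.hom_ext
        · exact (Functor.IsHereditaryEmbedding.hom_eq_zero ι (h i hi j hj).1 (h i hi j hj).2
            _).trans zero_comp.symm
        · rw [ih (_ ≫ biprod.snd), zero_comp]
    · rw [ih (biprod.inr ≫ _), comp_zero]

lemma comp_bijective {X : T} (hX : SumShifts ι I X) {M M' : T} (g : M ⟶ M')
    (hg : ∀ (a : A) (n : ℤ), Function.Bijective (fun y : (ι.obj a)⟦n⟧ ⟶ M ↦ y ≫ g)) :
    Function.Bijective (fun y : X ⟶ M ↦ y ≫ g) := by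
  induction hX with
  | zero hX => exact ⟨fun _ _ _ ↦ hX.eq_of_src _ _, fun _ ↦ ⟨0, hX.eq_of_src _ _⟩⟩
  | add a i hi _ e ih =>
    constructor
    · intro y₁ y₂ h
      dsimp only at h
      rw [← cancel_epi e.inv]
      apply biprod.hom_ext'
      · exact (hg a i).1 (by simp [h])
      · exact ih.1 (by simp [h])
    · intro z
      obtain ⟨y₁, h₁⟩ := (hg a i).2 (biprod.inl ≫ e.inv ≫ z)
      obtain ⟨y₂, h₂⟩ := ih.2 (biprod.inr ≫ e.inv ≫ z)
      refine ⟨e.hom ≫ biprod.desc y₁ y₂, ?_⟩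
      dsimp only at h₁ h₂ ⊢
      rw [← cancel_epi e.inv]
      apply biprod.hom_ext'
      · simpa using h₁
      · simpa using h₂

/-- Yoneda on the shifted objects of `A` extends to their finite sums, and both `M` and `M'` are
such sums. -/
lemma isIso_of_bijective {M M' : T} (hM : SumShifts ι I M) (hM' : SumShifts ι J M') (g : M ⟶ M')
    (hg : ∀ (a : A) (n : ℤ), Function.Bijective (fun y : (ι.obj a)⟦n⟧ ⟶ M ↦ y ≫ g)) :
    IsIso g := by
  obtain ⟨s, hs⟩ := (hM'.comp_bijective g hg).2 (𝟙 _)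
  dsimp only at hs
  exact ⟨s, (hM.comp_bijective g hg).1 (by simp [hs]), hs⟩

end SumShifts

end SumShifts

/-! ### The comparison functor -/

section Comparison

variable {A D T : Type*} [Category* A] [Abelian A]
  [Category* D] [HasZeroObject D] [HasShift D ℤ]
  [Preadditive D] [∀ n : ℤ, (shiftFunctor D n).Additive] [Pretriangulated D]
  [Category* T] [HasZeroObject T] [HasShift T ℤ]
  [Preadditive T] [∀ n : ℤ, (shiftFunctor T n).Additive] [Pretriangulated T]
  {ι₁ : A ⥤ D} {ι₂ : A ⥤ T}

/-- Through the two matchings, composition with `g` on morphisms from shifted objects of `A` becomes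
composition with the isomorphism `f`. This turns the comparison morphisms below, which lie over
identities, into isomorphisms. -/
lemma Match.Compat.isIso {X X' : D} {M M' : T} {m : Match ι₁ ι₂ X M} {m' : Match ι₁ ι₂ X' M'}
    {f : X ⟶ X'} {g : M ⟶ M'} (h : m.Compat m' f g) [IsIso f] {I J : Set ℤ}
    (hM : SumShifts ι₂ I M) (hM' : SumShifts ι₂ J M') : IsIso g := by
  refine SumShifts.isIso_of_bijective hM hM' g (fun a n ↦ ⟨fun y₁ y₂ hy ↦ ?_, fun y ↦ ?_⟩)
  · obtain ⟨x₁, h₁, _⟩ := m.existsUnique_left n y₁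
    obtain ⟨x₂, h₂, _⟩ := m.existsUnique_left n y₂
    have h₁' := h h₁
    have h₂' := h h₂
    dsimp only at hy
    rw [hy] at h₁'
    have := m'.eq_left h₁' h₂'
    rw [cancel_mono] at this
    subst this
    exact m.eq_right h₁ h₂
  · obtain ⟨x, hx, _⟩ := m'.existsUnique_left n y
    obtain ⟨z, hz, _⟩ := m.existsUnique_right n (x ≫ inv f)
    have := h hz
    rw [assoc, IsIso.inv_hom_id, comp_id] at this
    exact ⟨z, m'.eq_right this hx⟩

variable [ι₁.IsHereditaryEmbedding] [ι₂.IsHereditaryEmbedding]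

variable (ι₂) in
lemma SumShifts.exists_rigid {I : Set ℤ} {X : D} (hX : SumShifts ι₁ I X) :
    ∃ (M : T) (_ : SumShifts ι₂ I M) (m : Match ι₁ ι₂ X M), m.Rigid := by
  induction hX with
  | zero hX => exact ⟨0, .zero (isZero_zero T), _, Match.rigid_ofIsZero hX (isZero_zero T)⟩
  | add a i hi _ e ih =>
    obtain ⟨M, hM, m, hm⟩ := ih
    exact ⟨_, .add a i hi hM (Iso.refl _), _,
      ((Match.rigid_base a i).biprod hm).ofIso e (Iso.refl _)⟩

variable (ι₂) in
/-- Functions which choose, for every object of `D`, a rigidly matching object of `T`. -/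
structure MatchChoice (ι₁ : A ⥤ D) where
  /-- the object of `T` -/
  obj (X : D) : T
  /-- the matching -/
  match_ (X : D) : Match ι₁ ι₂ X (obj X)
  rigid (X : D) : (match_ X).Rigid
  sumShifts (X : D) : SumShifts ι₂ Set.univ (obj X)

variable (ι₂) in
lemma nonempty_matchChoice (h : ∀ X, SumShifts ι₁ Set.univ X) : Nonempty (MatchChoice ι₂ ι₁) := by
  choose M hM m hm using fun X ↦ (h X).exists_rigid ι₂
  exact ⟨⟨M, m, hm, hM⟩⟩

namespace MatchChoice

variable (c : MatchChoice ι₂ ι₁)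

/-- The morphism in `T` which is compatible with a morphism `X ⟶ X'` in `D`. -/
noncomputable def lift {X : D} {X' : D} {M' : T} (m' : Match ι₁ ι₂ X' M') (f : X ⟶ X') :
    c.obj X ⟶ M' :=
  ((c.rigid X).existsUnique_right m' f).choose

lemma compat_lift {X : D} {X' : D} {M' : T} (m' : Match ι₁ ι₂ X' M') (f : X ⟶ X') :
    (c.match_ X).Compat m' f (c.lift m' f) :=
  ((c.rigid X).existsUnique_right m' f).choose_spec.1

variable {c} in
lemma hom_ext {X : D} {X' : D} {M' : T} {m' : Match ι₁ ι₂ X' M'} {f : X ⟶ X'}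
    {g g' : c.obj X ⟶ M'} (hg : (c.match_ X).Compat m' f g) (hg' : (c.match_ X).Compat m' f g') :
    g = g' :=
  (((c.rigid X).existsUnique_right m' f).unique hg' hg).symm

/-- The functor `D ⥤ T` given by rigidly matching objects and compatible morphisms. -/
noncomputable def functor : D ⥤ T where
  obj := c.obj
  map f := c.lift (c.match_ _) f
  map_id _ := hom_ext (c.compat_lift _ _) (Match.Compat.id _)
  map_comp _ _ := hom_ext (c.compat_lift _ _) ((c.compat_lift _ _).comp (c.compat_lift _ _))

lemma compat_map {X X' : D} (f : X ⟶ X') :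
    (c.match_ X).Compat (c.match_ X') f (c.functor.map f) :=
  c.compat_lift _ _

instance : c.functor.Additive where
  map_add {_ _ f g} := hom_ext (c.compat_map _) ((c.compat_map f).add (c.compat_map g))

instance : c.functor.Full where
  map_surjective {X Y} g := by
    obtain ⟨f, hf, _⟩ := (c.rigid X).existsUnique_left (c.match_ Y) g
    exact ⟨f, hom_ext (c.compat_map f) hf⟩

instance : c.functor.Faithful where
  map_injective {X Y f f'} h := by
    refine ((c.rigid X).existsUnique_left (c.match_ Y) (c.functor.map f)).unique
      (c.compat_map f) ?_
    rw [h]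
    exact c.compat_map _

/-- The comparison of the matching object of a shift and the shift of the matching object. -/
noncomputable def shiftComparison (X : D) (k : ℤ) : c.obj (X⟦k⟧) ⟶ (c.obj X)⟦k⟧ :=
  c.lift ((c.match_ X).shift k) (𝟙 _)

lemma compat_shiftComparison (X : D) (k : ℤ) :
    (c.match_ (X⟦k⟧)).Compat ((c.match_ X).shift k) (𝟙 _) (c.shiftComparison X k) :=
  c.compat_lift _ _

instance (X : D) (k : ℤ) : IsIso (c.shiftComparison X k) :=
  (c.compat_shiftComparison X k).isIso (c.sumShifts _)
    ((c.sumShifts X).shift (J := Set.univ) k (by simp))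

/-- The commutation of the comparison functor with the shifts. -/
noncomputable def shiftIso (k : ℤ) :
    shiftFunctor D k ⋙ c.functor ≅ c.functor ⋙ shiftFunctor T k :=
  NatIso.ofComponents (fun X ↦ @asIso _ _ (c.obj (X⟦k⟧)) ((c.obj X)⟦k⟧)
    (c.shiftComparison X k) inferInstance) (fun {X Y} f ↦ by
    have h₁ := (c.compat_map (f⟦k⟧')).comp (c.compat_shiftComparison Y k)
    have h₂ := (c.compat_shiftComparison X k).comp ((c.compat_map f).shift k)
    rw [comp_id] at h₁
    rw [id_comp] at h₂
    exact hom_ext h₁ h₂)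

lemma shiftIso_hom_app (k : ℤ) (X : D) : (c.shiftIso k).hom.app X = c.shiftComparison X k := rfl

noncomputable instance : c.functor.CommShift ℤ where
  commShiftIso k := c.shiftIso k
  commShiftIso_zero := by
    ext X
    rw [shiftIso_hom_app, Functor.CommShift.isoZero_hom_app]
    have h := (c.compat_map ((shiftFunctorZero D ℤ).hom.app X)).comp
      (Match.compat_shiftFunctorZero_inv (c.match_ X))
    erw [Iso.hom_inv_id_app] at h
    exact hom_ext (c.compat_shiftComparison X 0) h
  commShiftIso_add a b := by
    ext X
    rw [Functor.CommShift.isoAdd_hom_app, shiftIso_hom_app, shiftIso_hom_app, shiftIso_hom_app]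
    have h := (c.compat_map ((shiftFunctorAdd D a b).hom.app X)).comp
      ((c.compat_shiftComparison (X⟦a⟧) b).comp (((c.compat_shiftComparison X a).shift b).comp
        (Match.compat_shiftFunctorAdd_inv (c.match_ X) a b)))
    rw [Functor.map_id, id_comp, id_comp] at h
    erw [Iso.hom_inv_id_app] at h
    exact hom_ext (c.compat_shiftComparison X (a + b)) h

variable (ι₁ ι₂) in
/-- The matching of the images of an object of `A`. -/
noncomputable def baseMatch (a : A) : Match ι₁ ι₂ (ι₁.obj a) (ι₂.obj a) :=
  (Match.base ι₁ ι₂ a 0).ofIso ((shiftFunctorZero D ℤ).symm.app _)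
    ((shiftFunctorZero T ℤ).symm.app _)

lemma baseMatch_rel (a : A) : (baseMatch ι₁ ι₂ a).rel 0
    ((shiftFunctorZero D ℤ).hom.app (ι₁.obj a)) ((shiftFunctorZero T ℤ).hom.app (ι₂.obj a)) := by
  have h := Match.BaseRel.id (ι₁ := ι₁) (ι₂ := ι₂) a 0
  rw [← Iso.hom_inv_id_app, ← Iso.hom_inv_id_app] at h
  exact h

/-- By Yoneda, compatibility with `baseMatch` may be tested on the universal element, the canonical
isomorphism from the zeroth shift. -/
lemma compat_of_rel {a : A} {X : D} {M : T} (m : Match ι₁ ι₂ X M) {f : ι₁.obj a ⟶ X}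
    {g : ι₂.obj a ⟶ M} (h : m.rel 0 ((shiftFunctorZero D ℤ).hom.app _ ≫ f)
      ((shiftFunctorZero T ℤ).hom.app _ ≫ g)) : (baseMatch ι₁ ι₂ a).Compat m f g := by
  intro b n x y hxy
  have := Match.BaseRel.comp_rel hxy m h
  simpa using this

lemma compat_baseMatch {a b : A} (u : a ⟶ b) :
    (baseMatch ι₁ ι₂ a).Compat (baseMatch ι₁ ι₂ b) (ι₁.map u) (ι₂.map u) := by
  apply compat_of_rel
  have := (baseMatch ι₁ ι₂ b).precomp u (baseMatch_rel b)
  rwa [NatTrans.naturality, NatTrans.naturality] at this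

lemma compat_baseMatch_shift {a b : A} {e : ι₁.obj a ⟶ (ι₁.obj b)⟦(1 : ℤ)⟧}
    {e' : ι₂.obj a ⟶ (ι₂.obj b)⟦(1 : ℤ)⟧} (he : ExtRel ι₁ ι₂ e e') :
    (baseMatch ι₁ ι₂ a).Compat ((baseMatch ι₁ ι₂ b).shift 1) e e' := by
  apply compat_of_rel
  -- The universal element of `b` sits at `n = 0`, so the extension class acts on it from `a⟦-1⟧`;
  -- shifting by 1 returns to degree 0.
  have := Match.shift_rel _ ((baseMatch ι₁ ι₂ b).precompExt he (n := -1) (by simp)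
    (baseMatch_rel b)) 1 0 (by simp)
  rw [shiftedHomShift_degreeOneShift_zero, shiftedHomShift_degreeOneShift_zero,
    Iso.inv_hom_id_app, Iso.inv_hom_id_app] at this
  simpa using this

/-- The comparison of the matching object of `ι₁ a` and `ι₂ a`. -/
noncomputable def baseComparison (a : A) : c.obj (ι₁.obj a) ⟶ ι₂.obj a :=
  c.lift (baseMatch ι₁ ι₂ a) (𝟙 _)

lemma compat_baseComparison (a : A) :
    (c.match_ (ι₁.obj a)).Compat (baseMatch ι₁ ι₂ a) (𝟙 _) (c.baseComparison a) :=
  c.compat_lift _ _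

instance (a : A) : IsIso (c.baseComparison a) :=
  (c.compat_baseComparison a).isIso (c.sumShifts _)
    ((SumShifts.single a (Set.mem_univ 0)).of_iso ((shiftFunctorZero T ℤ).symm.app _))

/-- The comparison functor extends the embedding of `A`. -/
noncomputable def compFunctorIso : ι₁ ⋙ c.functor ≅ ι₂ :=
  NatIso.ofComponents
    (fun a ↦ @asIso _ _ (c.obj (ι₁.obj a)) (ι₂.obj a) (c.baseComparison a) inferInstance)
    (fun {a b} u ↦ by
      have h₁ := (c.compat_map (ι₁.map u)).comp (c.compat_baseComparison b)
      have h₂ := (c.compat_baseComparison a).comp (compat_baseMatch u)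
      rw [comp_id] at h₁
      rw [id_comp] at h₂
      exact hom_ext h₁ h₂)

lemma map_comp_baseComparison {a b : A} {e : ι₁.obj a ⟶ (ι₁.obj b)⟦(1 : ℤ)⟧}
    {e' : ι₂.obj a ⟶ (ι₂.obj b)⟦(1 : ℤ)⟧} (he : ExtRel ι₁ ι₂ e e') :
    (c.functor.map e ≫ c.shiftComparison _ 1) ≫ (c.baseComparison b)⟦(1 : ℤ)⟧' =
      c.baseComparison a ≫ e' := by
  have h₁ := ((c.compat_map e).comp (c.compat_shiftComparison _ 1)).comp
    ((c.compat_baseComparison b).shift 1)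
  have h₂ := (c.compat_baseComparison a).comp (compat_baseMatch_shift he)
  rw [Functor.map_id, comp_id, comp_id] at h₁
  rw [id_comp] at h₂
  exact hom_ext h₁ h₂

/-- The same short exact sequence has a triangle in `T`, and its connecting morphism corresponds to
`h` under `ExtRel`, hence to the image of `h`. -/
lemma mapTriangle_distinguished {X Y Z : A} {f : X ⟶ Y} {g : Y ⟶ Z}
    {h : ι₁.obj Z ⟶ (ι₁.obj X)⟦(1 : ℤ)⟧}
    (hT : Triangle.mk (ι₁.map f) (ι₁.map g) h ∈ distTriang D) :
    c.functor.mapTriangle.obj (Triangle.mk (ι₁.map f) (ι₁.map g) h) ∈ distTriang T := by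
  obtain ⟨_, hS⟩ := Functor.IsExtensionEmbedding.shortExact_of_distTriang ι₁ hT
  obtain ⟨h', hT'⟩ := Functor.IsExtensionEmbedding.exists_distTriang (ι := ι₂) _ hS
  exact distTriang_of_iso hT' (c.compFunctorIso.app X) (c.compFunctorIso.app Y)
    (c.compFunctorIso.app Z) (c.compFunctorIso.hom.naturality f)
    (c.compFunctorIso.hom.naturality g) (c.map_comp_baseComparison ⟨Y, f, g, hT, hT'⟩)

end MatchChoice

end Comparison


/-- The inclusions and projections of a direct sum decomposition of an object `S` as `A ⊕ B`. -/
structure SplitData {C : Type*} [Category* C] [Preadditive C] (A S B : C) where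
  /-- the first inclusion -/
  inl : A ⟶ S
  /-- the second inclusion -/
  inr : B ⟶ S
  /-- the first projection -/
  fst : S ⟶ A
  /-- the second projection -/
  snd : S ⟶ B
  inl_fst : inl ≫ fst = 𝟙 A
  inr_snd : inr ≫ snd = 𝟙 B
  inl_snd : inl ≫ snd = 0
  inr_fst : inr ≫ fst = 0
  total : fst ≫ inl + snd ≫ inr = 𝟙 S

namespace SplitData

attribute [simp] inl_fst inr_snd inl_snd inr_fst

variable {C D : Type*} [Category* C] [Preadditive C] [Category* D] [Preadditive D]

/-- The decomposition with the two summands exchanged. -/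
@[simps]
def swap {A S B : C} (s : SplitData A S B) : SplitData B S A where
  inl := s.inr
  inr := s.inl
  fst := s.snd
  snd := s.fst
  inl_fst := s.inr_snd
  inr_snd := s.inl_fst
  inl_snd := s.inr_fst
  inr_fst := s.inl_snd
  total := by rw [add_comm, s.total]

/-- The image of a decomposition by an additive functor. -/
def map {A S B : C} (s : SplitData A S B) (F : C ⥤ D) [F.Additive] :
    SplitData (F.obj A) (F.obj S) (F.obj B) where
  inl := F.map s.inl
  inr := F.map s.inr
  fst := F.map s.fst
  snd := F.map s.snd
  inl_fst := by rw [← F.map_comp, s.inl_fst, F.map_id]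
  inr_snd := by rw [← F.map_comp, s.inr_snd, F.map_id]
  inl_snd := by rw [← F.map_comp, s.inl_snd, F.map_zero]
  inr_fst := by rw [← F.map_comp, s.inr_fst, F.map_zero]
  total := by rw [← F.map_comp, ← F.map_comp, ← F.map_add, s.total, F.map_id]

/-- The decomposition given by an isomorphism with a biproduct. -/
noncomputable def ofIso [HasBinaryBiproducts C] {A S B : C} (e : S ≅ A ⊞ B) :
    SplitData A S B where
  inl := biprod.inl ≫ e.inv
  inr := biprod.inr ≫ e.inv
  fst := e.hom ≫ biprod.fst
  snd := e.hom ≫ biprod.snd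
  inl_fst := by simp
  inr_snd := by simp
  inl_snd := by simp
  inr_fst := by simp
  total := by
    rw [← cancel_epi e.inv, ← cancel_mono e.hom]
    simp [biprod.total]

lemma hom_ext {A S B X : C} (s : SplitData A S B) {f g : X ⟶ S} (h₁ : f ≫ s.fst = g ≫ s.fst)
    (h₂ : f ≫ s.snd = g ≫ s.snd) : f = g := by
  rw [← comp_id f, ← comp_id g, ← s.total, comp_add, comp_add, reassoc_of% h₁, reassoc_of% h₂]

lemma hom_ext' {A S B X : C} (s : SplitData A S B) {f g : S ⟶ X} (h₁ : s.inl ≫ f = s.inl ≫ g)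
    (h₂ : s.inr ≫ f = s.inr ≫ g) : f = g := by
  rw [← id_comp f, ← id_comp g, ← s.total, add_comp, add_comp, assoc, assoc, assoc, assoc, h₁, h₂]

end SplitData

/-! ### Octahedra attached to a direct sum decomposition -/

section

variable {T : Type*} [Category* T] [HasZeroObject T] [HasShift T ℤ]
  [Preadditive T] [∀ n : ℤ, (shiftFunctor T n).Additive] [Pretriangulated T]

lemma SplitData.distinguished {A S B : T} (s : SplitData A S B) :
    Triangle.mk s.inl s.snd (0 : B ⟶ A⟦(1 : ℤ)⟧) ∈ distTriang T := by
  let e : S ≅ A ⊞ B :=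
    { hom := biprod.lift s.fst s.snd
      inv := biprod.desc s.inl s.inr
      hom_inv_id := by simp [biprod.lift_desc, s.total] }
  refine distTriang_of_iso (binaryBiproductTriangle_distinguished A B) (Iso.refl _) e (Iso.refl _)
    ?_ ?_ ?_
  · apply biprod.hom_ext <;> simp [e]
  · simp [e]
  · simp

variable [IsTriangulated T]

/-- The octahedron on `A ⟶ S ⟶ Y` computes the cone of `f` in two stages: first kill `A`, then kill
`B` in the result. The two final equations are recorded because they will characterize `m`. -/
lemma SplitData.exists_distinguished_of_source {A S B Y C E : T} (s : SplitData A S B) (f : S ⟶ Y)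
    {g : Y ⟶ C} {h : C ⟶ A⟦(1 : ℤ)⟧} (h₁ : Triangle.mk (s.inl ≫ f) g h ∈ distTriang T)
    {k : C ⟶ E} {l : E ⟶ B⟦(1 : ℤ)⟧} (h₂ : Triangle.mk (s.inr ≫ f ≫ g) k l ∈ distTriang T) :
    ∃ m : E ⟶ S⟦(1 : ℤ)⟧, Triangle.mk f (g ≫ k) m ∈ distTriang T ∧
      m ≫ s.snd⟦(1 : ℤ)⟧' = l ∧ k ≫ m = h ≫ s.inl⟦(1 : ℤ)⟧' := by
  obtain ⟨Z, v, w, hf⟩ := distinguished_cocone_triangle f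
  let o := Triangulated.someOctahedron rfl s.distinguished hf h₁
  have hm₁ : o.m₁ = s.inr ≫ f ≫ g := by
    rw [← id_comp o.m₁, ← s.inr_snd, assoc, o.comm₁]
  have hm : Triangle.mk (s.inr ≫ f ≫ g) o.m₃ (w ≫ s.snd⟦(1 : ℤ)⟧') ∈ distTriang T := by
    rw [← hm₁]
    exact o.mem
  obtain ⟨e, he₁, he₂⟩ := distTriang_iso₃ h₂ hm (Iso.refl _) (Iso.refl _) (by simp)
  simp only [Iso.refl_hom, Functor.map_id, comp_id, id_comp] at he₁ he₂
  refine ⟨e.hom ≫ w, ?_, ?_, ?_⟩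
  · refine distTriang_of_iso hf (Iso.refl _) (Iso.refl _) e (by simp) ?_ (by simp)
    simp [he₁, o.comm₃]
  · rw [assoc, he₂]
  · rw [reassoc_of% he₁, ← o.comm₄]

/-- Dually, the fiber of `f` is computed in two stages: `K` is the fiber of the component to `A`,
and `L` is the fiber of the induced morphism `K ⟶ B`. -/
lemma SplitData.exists_distinguished_of_target {A S B X K L : T} (s : SplitData A S B) (f : X ⟶ S)
    {k : K ⟶ X} {w : A ⟶ K⟦(1 : ℤ)⟧} (h₁ : Triangle.mk k (f ≫ s.fst) w ∈ distTriang T)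
    {l : L ⟶ K} {v : B ⟶ L⟦(1 : ℤ)⟧} (h₂ : Triangle.mk l (k ≫ f ≫ s.snd) v ∈ distTriang T) :
    ∃ m : S ⟶ L⟦(1 : ℤ)⟧, Triangle.mk (l ≫ k) f m ∈ distTriang T ∧
      s.inr ≫ m = v ∧ m ≫ l⟦(1 : ℤ)⟧' = s.fst ≫ w := by
  obtain ⟨Z, a, b, hf⟩ := distinguished_cocone_triangle₁ f
  let o := Triangulated.someOctahedron' rfl hf s.swap.distinguished h₁
  have hm₃ : o.m₃ = k ≫ f ≫ s.snd := by
    rw [← comp_id o.m₃, ← s.inr_snd]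
    exact o.comm₄_assoc _
  have hm : Triangle.mk o.m₁ (k ≫ f ≫ s.snd) (s.inr ≫ b) ∈ distTriang T := by
    rw [← hm₃]
    exact o.mem
  obtain ⟨e, he₁, he₂⟩ := distTriang_iso₁ h₂ hm (Iso.refl _) (Iso.refl _) (by simp)
  simp only [Iso.refl_hom, comp_id, id_comp] at he₁ he₂
  refine ⟨b ≫ e.inv⟦(1 : ℤ)⟧', ?_, ?_, ?_⟩
  · refine distTriang_of_iso hf e (Iso.refl _) (Iso.refl _) ?_ (by simp) ?_
    · simp [he₁, o.comm₁]
    · simp [← Functor.map_comp]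
  · rw [← assoc, ← he₂, assoc, ← Functor.map_comp]
    simp
  · rw [he₁, assoc, ← Functor.map_comp, e.inv_hom_id_assoc, o.comm₂]
    rfl

end


/-- The difference `m - m'` vanishes on `k`, so it factors through `B⟦1⟧`. Its component in `A⟦1⟧`
is then zero since there are no morphisms `B ⟶ A`, and its component in `B⟦1⟧` is zero by `h₁`. -/
lemma SplitData.eq_of_source {T : Type*} [Category* T] [HasZeroObject T] [HasShift T ℤ]
    [Preadditive T] [∀ n : ℤ, (shiftFunctor T n).Additive] [Pretriangulated T]
    {A S B C E : T} (s : SplitData A S B) (hBA : ∀ φ : B ⟶ A, φ = 0)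
    {p : B ⟶ C} {k : C ⟶ E} {l : E ⟶ B⟦(1 : ℤ)⟧} (h : Triangle.mk p k l ∈ distTriang T)
    {m m' : E ⟶ S⟦(1 : ℤ)⟧} (h₁ : m ≫ s.snd⟦(1 : ℤ)⟧' = m' ≫ s.snd⟦(1 : ℤ)⟧')
    (h₂ : k ≫ m = k ≫ m') : m = m' := by
  obtain ⟨d, hd⟩ := distTriang_yoneda₃ h (m - m') (by rw [comp_sub, h₂, sub_self])
  have hd' : d ≫ s.fst⟦(1 : ℤ)⟧' = 0 := by
    obtain ⟨φ, hφ⟩ := (shiftFunctor T (1 : ℤ)).map_surjective (d ≫ s.fst⟦(1 : ℤ)⟧')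
    rw [← hφ, hBA φ, Functor.map_zero]
  refine (s.map (shiftFunctor T (1 : ℤ))).hom_ext ?_ h₁
  rw [← sub_eq_zero, ← sub_comp, hd, assoc]
  exact (congrArg (l ≫ ·) hd').trans comp_zero

/-- The difference `m - m'` factors through `v` by a morphism `S ⟶ B`, which is zero on `A`; on `B`
the difference is zero by `h₁`. -/
lemma SplitData.eq_of_target {T : Type*} [Category* T] [HasZeroObject T] [HasShift T ℤ]
    [Preadditive T] [∀ n : ℤ, (shiftFunctor T n).Additive] [Pretriangulated T]
    {A S B K L : T} (s : SplitData A S B) (hAB : ∀ φ : A ⟶ B, φ = 0)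
    {l : L ⟶ K} {p : K ⟶ B} {v : B ⟶ L⟦(1 : ℤ)⟧} (h : Triangle.mk l p v ∈ distTriang T)
    {m m' : S ⟶ L⟦(1 : ℤ)⟧} (h₁ : s.inr ≫ m = s.inr ≫ m')
    (h₂ : m ≫ l⟦(1 : ℤ)⟧' = m' ≫ l⟦(1 : ℤ)⟧') : m = m' := by
  obtain ⟨d, hd⟩ := distTriang_coyoneda₁ h (m - m') (by rw [sub_comp, h₂, sub_self])
  refine s.hom_ext' ?_ h₁
  rw [← sub_eq_zero, ← comp_sub, hd, ← assoc, hAB (s.inl ≫ d), zero_comp]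

/-! ### Functors preserving the cones of given morphisms -/

namespace Functor

section

variable {D T : Type*}
  [Category* D] [HasZeroObject D] [HasShift D ℤ]
  [Preadditive D] [∀ n : ℤ, (shiftFunctor D n).Additive] [Pretriangulated D]
  [Category* T] [HasZeroObject T] [HasShift T ℤ]
  [Preadditive T] [∀ n : ℤ, (shiftFunctor T n).Additive] [Pretriangulated T]
  (F : D ⥤ T) [F.CommShift ℤ] [F.Additive]

/-- A distinguished triangle whose image by the functor `F` is distinguished. -/
def BiDistinguished (Δ : Triangle D) : Prop :=
  Δ ∈ distTriang D ∧ F.mapTriangle.obj Δ ∈ distTriang T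

/-- The functor `F` preserves the distinguished triangles with a given first morphism. -/
def PreservesCone {X Y : D} (f : X ⟶ Y) : Prop :=
  ∃ (Z : D) (g : Y ⟶ Z) (h : Z ⟶ X⟦(1 : ℤ)⟧), F.BiDistinguished (Triangle.mk f g h)

variable {F}

namespace BiDistinguished

lemma map {X Y Z : D} {f : X ⟶ Y} {g : Y ⟶ Z} {h : Z ⟶ X⟦(1 : ℤ)⟧}
    (H : F.BiDistinguished (Triangle.mk f g h)) :
    Triangle.mk (F.map f) (F.map g) (F.map h ≫ (F.commShiftIso 1).hom.app X) ∈ distTriang T :=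
  H.2

lemma rotate_iff {X Y Z : D} {f : X ⟶ Y} {g : Y ⟶ Z} {h : Z ⟶ X⟦(1 : ℤ)⟧} :
    F.BiDistinguished (Triangle.mk g h (-f⟦(1 : ℤ)⟧')) ↔
      F.BiDistinguished (Triangle.mk f g h) :=
  and_congr (rotate_distinguished_triangle (Triangle.mk f g h)).symm
    ((distinguished_iff_of_iso (F.mapTriangleRotateIso.app (Triangle.mk f g h))).symm.trans
      (rotate_distinguished_triangle (F.mapTriangle.obj (Triangle.mk f g h))).symm)

lemma preservesCone₁ {X Y Z : D} {f : X ⟶ Y} {g : Y ⟶ Z} {h : Z ⟶ X⟦(1 : ℤ)⟧}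
    (H : F.BiDistinguished (Triangle.mk f g h)) : F.PreservesCone f := ⟨Z, g, h, H⟩

lemma preservesCone₂ {X Y Z : D} {f : X ⟶ Y} {g : Y ⟶ Z} {h : Z ⟶ X⟦(1 : ℤ)⟧}
    (H : F.BiDistinguished (Triangle.mk f g h)) : F.PreservesCone g :=
  (rotate_iff.2 H).preservesCone₁

lemma of_splitData {X S Y : D} (s : SplitData X S Y) :
    F.BiDistinguished (Triangle.mk s.inl s.snd 0) := by
  refine ⟨s.distinguished, ?_⟩
  have : Triangle.mk (F.map s.inl) (F.map s.snd)
      (F.map (0 : Y ⟶ X⟦(1 : ℤ)⟧) ≫ (F.commShiftIso 1).hom.app X) ∈ distTriang T := by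
    rw [F.map_zero, zero_comp]
    exact (s.map F).distinguished
  exact this

end BiDistinguished

namespace PreservesCone

/-- Distinguished triangles with isomorphic first morphisms are isomorphic, so one well-behaved
triangle is enough for all of them. -/
lemma biDistinguished_of_iso {X Y : D} {f : X ⟶ Y} (H : F.PreservesCone f) {X' Y' Z' : D}
    {f' : X' ⟶ Y'} {g' : Y' ⟶ Z'} {h' : Z' ⟶ X'⟦(1 : ℤ)⟧}
    (H' : Triangle.mk f' g' h' ∈ distTriang D) (a : X' ≅ X) (b : Y' ≅ Y)
    (comm : f' ≫ b.hom = a.hom ≫ f) : F.BiDistinguished (Triangle.mk f' g' h') := by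
  obtain ⟨Z, g, h, H⟩ := H
  obtain ⟨c, hc₁, hc₂⟩ := distTriang_iso₃ H' H.1 a b comm
  refine ⟨H', (distinguished_iff_of_iso (F.mapTriangle.mapIso ?_)).2 H.2⟩
  exact Triangle.isoMk _ _ a b c comm hc₁ hc₂

lemma biDistinguished {X Y Z : D} {f : X ⟶ Y} (H : F.PreservesCone f) {g : Y ⟶ Z}
    {h : Z ⟶ X⟦(1 : ℤ)⟧} (H' : Triangle.mk f g h ∈ distTriang D) :
    F.BiDistinguished (Triangle.mk f g h) :=
  H.biDistinguished_of_iso H' (Iso.refl _) (Iso.refl _) (by simp)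

lemma of_iso {X Y : D} {f : X ⟶ Y} (H : F.PreservesCone f) {X' Y' : D} {f' : X' ⟶ Y'}
    (a : X' ≅ X) (b : Y' ≅ Y) (comm : f' ≫ b.hom = a.hom ≫ f) : F.PreservesCone f' := by
  obtain ⟨Z', g', h', H'⟩ := distinguished_cocone_triangle f'
  exact (H.biDistinguished_of_iso H' a b comm).preservesCone₁

lemma of_precomp_iso {X Y : D} {X' : D} {f : X ⟶ Y} (a : X' ≅ X)
    (H : F.PreservesCone (a.hom ≫ f)) : F.PreservesCone f :=
  H.of_iso a.symm (Iso.refl _) (by simp)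

lemma of_postcomp_iso {X Y : D} {Y' : D} {f : X ⟶ Y} (b : Y ≅ Y')
    (H : F.PreservesCone (f ≫ b.hom)) : F.PreservesCone f :=
  H.of_iso (Iso.refl _) b (by simp)

lemma exists_fiber {Y Z : D} {g : Y ⟶ Z} (H : F.PreservesCone g) :
    ∃ (X : D) (f : X ⟶ Y) (h : Z ⟶ X⟦(1 : ℤ)⟧), F.BiDistinguished (Triangle.mk f g h) := by
  obtain ⟨X, f, h, H'⟩ := distinguished_cocone_triangle₁ g
  exact ⟨X, f, h, BiDistinguished.rotate_iff.1 (H.biDistinguished (distTriang_rotate H'))⟩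

lemma zero (X Y : D) : F.PreservesCone (0 : X ⟶ Y) := by
  let s : SplitData Y (Y ⊞ X⟦(1 : ℤ)⟧) (X⟦(1 : ℤ)⟧) := .ofIso (Iso.refl _)
  have H : F.BiDistinguished (Triangle.mk s.inl s.snd 0) := .of_splitData s
  exact (BiDistinguished.rotate_iff (f := (0 : X ⟶ Y)).1 (by simpa using H)).preservesCone₁

/-- The hypothesis uses the first morphism of a shifted triangle, rather than `f⟦n⟧'`, so as to
include the sign of the triangle shift. The zero object is only a placeholder. -/
lemma of_shift {X Y : D} {f : X ⟶ Y} (n : ℤ)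
    (H : F.PreservesCone ((Triangle.shiftFunctor D n).obj
      (Triangle.mk f (0 : Y ⟶ 0) (0 : 0 ⟶ X⟦(1 : ℤ)⟧))).mor₁) :
    F.PreservesCone f := by
  obtain ⟨Z, g, h, H'⟩ := distinguished_cocone_triangle f
  refine ⟨Z, g, h, H', ?_⟩
  have := (H.biDistinguished (Triangle.shift_distinguished _ H' n)).2
  rw [← Triangle.shift_distinguished_iff _ n]
  exact (distinguished_iff_of_iso ((F.mapTriangle.commShiftIso n).app _)).1 this

section

variable [CategoryTheory.IsTriangulated D] [CategoryTheory.IsTriangulated T] [F.Full]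

lemma exists_of_source {A S B Y C E : D} (s : SplitData A S B) (hBA : ∀ φ : B ⟶ A, φ = 0)
    (f : S ⟶ Y) {g : Y ⟶ C} {h : C ⟶ A⟦(1 : ℤ)⟧}
    (h₁ : F.BiDistinguished (Triangle.mk (s.inl ≫ f) g h))
    {k : C ⟶ E} {l : E ⟶ B⟦(1 : ℤ)⟧}
    (h₂ : F.BiDistinguished (Triangle.mk (s.inr ≫ f ≫ g) k l)) :
    ∃ m : E ⟶ S⟦(1 : ℤ)⟧, F.BiDistinguished (Triangle.mk f (g ≫ k) m) := by
  obtain ⟨m, hm, hm₁, hm₂⟩ := s.exists_distinguished_of_source f h₁.1 h₂.1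
  have h₁' := h₁.map
  have h₂' := h₂.map
  rw [F.map_comp] at h₁'
  rw [F.map_comp, F.map_comp] at h₂'
  obtain ⟨m', hm', hm₁', hm₂'⟩ := (s.map F).exists_distinguished_of_source (F.map f) h₁' h₂'
  have e₁ : (F.map m ≫ (F.commShiftIso 1).hom.app S) ≫ (F.map s.snd)⟦(1 : ℤ)⟧' =
      F.map l ≫ (F.commShiftIso 1).hom.app B := by
    rw [assoc, ← F.commShiftIso_hom_naturality, ← F.map_comp_assoc, hm₁]
  have e₂ : F.map k ≫ F.map m ≫ (F.commShiftIso 1).hom.app S =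
      (F.map h ≫ (F.commShiftIso 1).hom.app A) ≫ (F.map s.inl)⟦(1 : ℤ)⟧' := by
    rw [assoc, ← F.commShiftIso_hom_naturality, ← F.map_comp_assoc, ← F.map_comp_assoc, hm₂]
  -- The octahedra in `D` and in `T` are chosen independently; the uniqueness lemma forces their
  -- connecting morphisms to agree, with fullness carrying the Hom vanishing to the image of `F`.
  have hmm : F.map m ≫ (F.commShiftIso 1).hom.app S = m' := by
    refine (s.map F).eq_of_source (fun φ ↦ ?_) h₂' (e₁.trans hm₁'.symm) (e₂.trans hm₂'.symm)
    obtain ⟨φ, rfl⟩ := F.map_surjective φ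
    rw [hBA φ, F.map_zero]
  refine ⟨m, hm, ?_⟩
  have : Triangle.mk (F.map f) (F.map (g ≫ k)) (F.map m ≫ (F.commShiftIso 1).hom.app S) ∈
      distTriang T := by
    rw [hmm, F.map_comp]
    exact hm'
  exact this

lemma exists_of_target {A S B X K L : D} (s : SplitData A S B) (hAB : ∀ φ : A ⟶ B, φ = 0)
    (f : X ⟶ S) {k : K ⟶ X} {w : A ⟶ K⟦(1 : ℤ)⟧}
    (h₁ : F.BiDistinguished (Triangle.mk k (f ≫ s.fst) w))
    {l : L ⟶ K} {v : B ⟶ L⟦(1 : ℤ)⟧}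
    (h₂ : F.BiDistinguished (Triangle.mk l (k ≫ f ≫ s.snd) v)) :
    ∃ m : S ⟶ L⟦(1 : ℤ)⟧, F.BiDistinguished (Triangle.mk (l ≫ k) f m) := by
  obtain ⟨m, hm, hm₁, hm₂⟩ := s.exists_distinguished_of_target f h₁.1 h₂.1
  have h₁' := h₁.map
  have h₂' := h₂.map
  rw [F.map_comp] at h₁'
  rw [F.map_comp, F.map_comp] at h₂'
  obtain ⟨m', hm', hm₁', hm₂'⟩ := (s.map F).exists_distinguished_of_target (F.map f) h₁' h₂'
  have e₁ : F.map s.inr ≫ F.map m ≫ (F.commShiftIso 1).hom.app L =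
      F.map v ≫ (F.commShiftIso 1).hom.app L := by
    rw [← F.map_comp_assoc, hm₁]
  have e₂ : (F.map m ≫ (F.commShiftIso 1).hom.app L) ≫ (F.map l)⟦(1 : ℤ)⟧' =
      F.map s.fst ≫ F.map w ≫ (F.commShiftIso 1).hom.app K := by
    rw [assoc, ← F.commShiftIso_hom_naturality, ← F.map_comp_assoc, ← F.map_comp_assoc, hm₂]
  have hmm : F.map m ≫ (F.commShiftIso 1).hom.app L = m' := by
    refine (s.map F).eq_of_target (fun φ ↦ ?_) h₂' (e₁.trans hm₁'.symm) (e₂.trans hm₂'.symm)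
    obtain ⟨φ, rfl⟩ := F.map_surjective φ
    rw [hAB φ, F.map_zero]
  refine ⟨m, hm, ?_⟩
  have : Triangle.mk (F.map (l ≫ k)) (F.map f) (F.map m ≫ (F.commShiftIso 1).hom.app L) ∈
      distTriang T := by
    rw [hmm, F.map_comp]
    exact hm'
  exact this

/-- In `h₂` the morphism `g` is arbitrary because the cone of `s.inl ≫ f` is only known to exist. -/
lemma of_source {A S B Y : D} (s : SplitData A S B) (hBA : ∀ φ : B ⟶ A, φ = 0) (f : S ⟶ Y)
    (h₁ : F.PreservesCone (s.inl ≫ f))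
    (h₂ : ∀ ⦃C : D⦄ (g : Y ⟶ C), F.PreservesCone (s.inr ≫ f ≫ g)) : F.PreservesCone f := by
  obtain ⟨C, g, h, H⟩ := h₁
  obtain ⟨E, k, l, H'⟩ := h₂ g
  obtain ⟨m, hm⟩ := exists_of_source s hBA f H H'
  exact hm.preservesCone₁

lemma of_comp_snd_eq_zero {A S B X : D} (s : SplitData A S B) (hAB : ∀ φ : A ⟶ B, φ = 0)
    (f : X ⟶ S) (h₁ : F.PreservesCone (f ≫ s.fst)) (h₂ : f ≫ s.snd = 0) :
    F.PreservesCone f := by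
  obtain ⟨K, k, w, H⟩ := h₁.exists_fiber
  obtain ⟨L, l, v, H'⟩ := (PreservesCone.zero (F := F) K B).exists_fiber
  obtain ⟨m, hm⟩ := exists_of_target s hAB f H (l := l) (v := v) (by rwa [h₂, comp_zero])
  exact hm.preservesCone₂

/-- The first summand is written as a shift so that the fiber of the zero morphism `X ⟶ A⟦1⟧` is
visibly `A ⊞ X`. The second stage then concerns a morphism from `A ⊞ X` that is zero on `A`, to
which `of_source` applies. -/
lemma of_comp_fst_eq_zero {A S B X : D} (s : SplitData (A⟦(1 : ℤ)⟧) S B)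
    (hAB : ∀ φ : A⟦(1 : ℤ)⟧ ⟶ B, φ = 0) (hAX : ∀ φ : A ⟶ X, φ = 0)
    (f : X ⟶ S) (h₁ : f ≫ s.fst = 0) (h₂ : F.PreservesCone (f ≫ s.snd)) :
    F.PreservesCone f := by
  let t : SplitData A (A ⊞ X) X := .ofIso (Iso.refl _)
  have ht : F.BiDistinguished (Triangle.mk t.snd (f ≫ s.fst) (-t.inl⟦(1 : ℤ)⟧')) := by
    rw [h₁]
    exact BiDistinguished.rotate_iff.2 (.of_splitData t)
  have H : F.PreservesCone (t.snd ≫ f ≫ s.snd) := by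
    refine of_source t.swap hAX _ ?_ (fun C g ↦ ?_)
    · have : t.swap.inl ≫ t.snd ≫ f ≫ s.snd = f ≫ s.snd := by
        rw [SplitData.swap_inl, ← assoc, t.inr_snd, id_comp]
      rwa [this]
    · have : t.swap.inr ≫ (t.snd ≫ f ≫ s.snd) ≫ g = 0 := by
        rw [SplitData.swap_inr, assoc, ← assoc, t.inl_snd, zero_comp]
      rw [this]
      exact .zero _ _
  obtain ⟨L, l, v, H'⟩ := H.exists_fiber
  obtain ⟨m, hm⟩ := exists_of_target s hAB f ht H'
  exact hm.preservesCone₂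

end

end PreservesCone

end

end Functor


/-- The extension `W` of `Q` by `X` maps by `b` to the extension `Y` of `Q` by the quotient `I` of
`X`, with the identity on `Q`. Hence `b` is an epimorphism with the same kernel `K` as `p`. -/
lemma shortExact_of_extension_of_image {A : Type*} [Category* A] [Abelian A]
    {K X I W Y Q : A} {k : K ⟶ X} {p : X ⟶ I} {i : I ⟶ Y} {π : Y ⟶ Q} {l : X ⟶ W} {r : W ⟶ Q}
    {b : W ⟶ Y} (w₁ : k ≫ p = 0) (w₂ : i ≫ π = 0) (w₃ : l ≫ r = 0)
    (h₁ : (ShortComplex.mk k p w₁).ShortExact) (h₂ : (ShortComplex.mk i π w₂).ShortExact)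
    (h₃ : (ShortComplex.mk l r w₃).ShortExact) (hl : l ≫ b = p ≫ i) (hr : b ≫ π = r) :
    ∃ w : (k ≫ l) ≫ b = 0, (ShortComplex.mk (k ≫ l) b w).ShortExact := by
  have := h₁.mono_f
  have := h₁.epi_g
  have := h₂.mono_f
  have := h₂.epi_g
  have := h₃.mono_f
  have := h₃.epi_g
  dsimp at *
  have w : (k ≫ l) ≫ b = 0 := by rw [assoc, hl, reassoc_of% w₁, zero_comp]
  have hm : Mono (k ≫ l) := inferInstance
  have he : Epi b := by
    rw [epi_iff_cancel_zero]
    intro Z t ht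
    have hit : i ≫ t = 0 := by
      rw [← cancel_epi p, ← assoc, ← hl, assoc, ht, comp_zero, comp_zero]
    obtain ⟨s, rfl⟩ : ∃ s, π ≫ s = t := ⟨h₂.exact.desc t hit, h₂.exact.g_desc t hit⟩
    have : s = 0 := by rw [← cancel_epi r, ← hr, assoc, ht, comp_zero]
    rw [this, comp_zero]
  refine ⟨w, { exact := ?_ }⟩
  refine ShortComplex.exact_of_f_is_kernel _ (KernelFork.IsLimit.ofι' _ _ (fun {Z} x hx ↦ ?_))
  dsimp at x hx
  have hxr : x ≫ r = 0 := by rw [← hr, reassoc_of% hx, zero_comp]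
  have hy : h₃.exact.lift x hxr ≫ p = 0 := by
    rw [← cancel_mono i, assoc, ← hl, ← assoc, h₃.exact.lift_f x hxr, hx, zero_comp]
  refine ⟨h₁.exact.lift _ hy, ?_⟩
  dsimp
  have e₁ := h₁.exact.lift_f _ hy
  have e₂ := h₃.exact.lift_f x hxr
  dsimp at e₁ e₂
  rw [← assoc, e₁, e₂]

/-! ### From short exact sequences to all triangles -/

namespace Functor

variable {A D T : Type*} [Category* A] [Abelian A]
  [Category* D] [HasZeroObject D] [HasShift D ℤ]
  [Preadditive D] [∀ n : ℤ, (shiftFunctor D n).Additive] [Pretriangulated D]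
  [Category* T] [HasZeroObject T] [HasShift T ℤ]
  [Preadditive T] [∀ n : ℤ, (shiftFunctor T n).Additive] [Pretriangulated T]
  (ι : A ⥤ D) [ι.IsHereditaryEmbedding]

/-- The obstruction to lifting lies in `Hom(Q, K⟦2⟧)`, which vanishes. The sign in the witness comes
from rotating the triangle twice. -/
lemma IsHereditaryEmbedding.exists_lift_ext {K X I Q : A} {k : K ⟶ X} {p : X ⟶ I}
    {h : ι.obj I ⟶ (ι.obj K)⟦(1 : ℤ)⟧} (hT : Triangle.mk (ι.map k) (ι.map p) h ∈ distTriang D)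
    (x : ι.obj Q ⟶ (ι.obj I)⟦(1 : ℤ)⟧) :
    ∃ y : ι.obj Q ⟶ (ι.obj X)⟦(1 : ℤ)⟧, y ≫ (ι.map p)⟦(1 : ℤ)⟧' = x := by
  have hx : x ≫ h⟦(1 : ℤ)⟧' = 0 := by
    rw [← cancel_mono ((shiftFunctorAdd' D 1 1 2 (by simp)).inv.app (ι.obj K)), zero_comp]
    exact hom_shift_eq_zero (ι := ι) 2 (by simp) (by simp) _
  obtain ⟨y, hy⟩ := distTriang_coyoneda₁ (distTriang_rotate (distTriang_rotate hT)) x hx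
  exact ⟨-y, by rw [hy, neg_comp, comp_neg]⟩

variable [CategoryTheory.IsTriangulated D] [CategoryTheory.IsTriangulated T]
  (F : D ⥤ T) [F.CommShift ℤ] [F.Additive] [F.Full]

/-- The functor `F` preserves the distinguished triangles given by the short exact sequences
in `A`. -/
def PreservesExtensions : Prop :=
  ∀ ⦃X Y Z : A⦄ (f : X ⟶ Y) (g : Y ⟶ Z) (h : ι.obj Z ⟶ (ι.obj X)⟦(1 : ℤ)⟧),
    Triangle.mk (ι.map f) (ι.map g) h ∈ distTriang D →
      F.mapTriangle.obj (Triangle.mk (ι.map f) (ι.map g) h) ∈ distTriang T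

namespace PreservesExtensions

open IsExtensionEmbedding

variable {ι F} (hF : PreservesExtensions ι F)

include hF

lemma biDistinguished {X Y Z : A} {f : X ⟶ Y} {g : Y ⟶ Z} {h : ι.obj Z ⟶ (ι.obj X)⟦(1 : ℤ)⟧}
    (hT : Triangle.mk (ι.map f) (ι.map g) h ∈ distTriang D) :
    F.BiDistinguished (Triangle.mk (ι.map f) (ι.map g) h) :=
  ⟨hT, hF f g h hT⟩

/-- In a hereditary category the cone of `u` is `(ker u)⟦1⟧ ⊞ coker u`. To express it by short exact
sequences, the class of `0 → im u → Y → coker u → 0` is lifted along `X ⟶ im u` to an extension `W`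
of `coker u` by `X`. Then `u` is the composite of `l : X ⟶ W`, with cokernel `coker u`, and `b : W ⟶
Y`, with kernel `ker u`. -/
lemma preservesCone_map {X Y : A} (u : X ⟶ Y) : F.PreservesCone (ι.map u) := by
  let p := Abelian.factorThruImage u
  let i := Abelian.image.ι u
  have hpi : p ≫ i = u := Abelian.image.fac u
  have w₁ : kernel.ι u ≫ p = 0 := by rw [← cancel_mono i, assoc, hpi]; simp
  have w₂ : i ≫ cokernel.π u = 0 := kernel.condition _
  have h₁ : (ShortComplex.mk (kernel.ι u) p w₁).ShortExact :=
    { exact := ShortComplex.exact_of_f_is_kernel _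
        (KernelFork.IsLimit.ofι' _ _ (fun {Z} x hx ↦
          ⟨kernel.lift u x (by dsimp at hx; rw [← hpi, reassoc_of% hx, zero_comp]), by simp⟩)) }
  have h₂ : (ShortComplex.mk i (cokernel.π u) w₂).ShortExact :=
    { exact := ShortComplex.exact_of_f_is_kernel _ (kernelIsKernel _) }
  obtain ⟨d₁, hd₁⟩ := exists_distTriang (ι := ι) _ h₁
  obtain ⟨d₂, hd₂⟩ := exists_distTriang (ι := ι) _ h₂
  dsimp only at d₁ d₂ hd₁ hd₂
  obtain ⟨ε, hε⟩ := IsHereditaryEmbedding.exists_lift_ext ι hd₁ d₂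
  obtain ⟨W, l, r, hW⟩ := exists_extension ε
  obtain ⟨w₃, h₃⟩ := shortExact_of_distTriang ι hW
  obtain ⟨b, hb₁, hb₂⟩ := distTriang_complete₂ hW hd₂ (ι.map p) (𝟙 _) (by rw [hε, id_comp])
  obtain ⟨b, rfl⟩ := ι.map_surjective b
  have hl : l ≫ b = p ≫ i := ι.map_injective (by rw [ι.map_comp, ι.map_comp, hb₁])
  have hr : b ≫ cokernel.π u = r := ι.map_injective (by rw [ι.map_comp, ← hb₂, comp_id])
  obtain ⟨w₄, h₄⟩ := shortExact_of_extension_of_image w₁ w₂ w₃ h₁ h₂ h₃ hl hr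
  obtain ⟨d, hd⟩ := exists_distTriang (ι := ι) _ h₄
  dsimp only at d hd
  let s : SplitData ((ι.obj (Limits.kernel u))⟦(1 : ℤ)⟧)
    ((ι.obj (Limits.kernel u))⟦(1 : ℤ)⟧ ⊞ ι.obj (cokernel u)) (ι.obj (cokernel u)) :=
    .ofIso (Iso.refl _)
  -- This is to be the second morphism of the triangle of `u`: its fiber, taken one component at a
  -- time, is first `W` and then `X`.
  let f := d ≫ s.inl + ι.map (cokernel.π u) ≫ s.inr
  have hf₁ : f ≫ s.fst = d := by
    rw [add_comp, assoc, assoc, s.inl_fst, s.inr_fst, comp_id, comp_zero, add_zero]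
  have hf₂ : f ≫ s.snd = ι.map (cokernel.π u) := by
    rw [add_comp, assoc, assoc, s.inl_snd, s.inr_snd, comp_id, comp_zero, zero_add]
  have H₁ : F.BiDistinguished (Triangle.mk (ι.map b) (f ≫ s.fst)
      (-(ι.map (kernel.ι u ≫ l))⟦(1 : ℤ)⟧')) := by
    rw [hf₁]
    exact BiDistinguished.rotate_iff.2 (hF.biDistinguished hd)
  have H₂ : F.BiDistinguished (Triangle.mk (ι.map l) (ι.map b ≫ f ≫ s.snd) ε) := by
    rw [hf₂, ← ι.map_comp, hr]
    exact hF.biDistinguished hW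
  obtain ⟨m, hm⟩ := PreservesCone.exists_of_target s (fun φ ↦ by
    rw [← cancel_mono ((shiftFunctorZero D ℤ).inv.app _), zero_comp]
    exact IsHereditaryEmbedding.hom_eq_zero ι (by simp) (by simp) _) f H₁ H₂
  have := hm.preservesCone₁
  rwa [← ι.map_comp, hl, hpi] at this

/-- The fiber of the component `X ⟶ Y⟦1⟧` is an extension `E` in `A`; what remains is a morphism `E
⟶ Z` of `A`. -/
lemma preservesCone_of_degrees_zero_one {X Y Z : A} {S : D}
    (s : SplitData ((ι.obj Y)⟦(1 : ℤ)⟧) S ((ι.obj Z)⟦(0 : ℤ)⟧)) (f : ι.obj X ⟶ S) :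
    F.PreservesCone f := by
  obtain ⟨E, a, b, hE⟩ := exists_extension (f ≫ s.fst)
  have H₁ := BiDistinguished.rotate_iff.2 (hF.biDistinguished hE)
  have H₂ : F.PreservesCone (ι.map b ≫ f ≫ s.snd) := by
    apply PreservesCone.of_postcomp_iso ((shiftFunctorZero D ℤ).app _)
    obtain ⟨v, hv⟩ := ι.map_surjective ((ι.map b ≫ f ≫ s.snd) ≫
      ((shiftFunctorZero D ℤ).app (ι.obj Z)).hom)
    rw [← hv]
    exact hF.preservesCone_map v
  obtain ⟨L, l, v, H₂⟩ := H₂.exists_fiber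
  obtain ⟨m, hm⟩ := PreservesCone.exists_of_target s
    (fun φ ↦ IsHereditaryEmbedding.hom_eq_zero ι (by simp) (by simp) _) f H₁ H₂
  exact hm.preservesCone₂

lemma preservesCone_of_source {X : A} {Y : D} (hY : SumShifts ι Set.univ Y) (f : ι.obj X ⟶ Y) :
    F.PreservesCone f := by
  have hX : SumShifts ι {0} (ι.obj X) :=
    (SumShifts.single X (Set.mem_singleton 0)).of_iso ((shiftFunctorZero D ℤ).symm.app _)
  -- Only the shifts 0 and 1 receive nonzero morphisms from `X`. The bound 2 leaves `Y₁⟦-1⟧` with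
  -- shifts at least 1, so that it has no nonzero morphism to `X`. Higher shifts are split off
  -- first, since nonzero morphisms cannot lower the shift.
  obtain ⟨Y₁, Y₂, h₁, h₂, ⟨e⟩⟩ := hY.exists_iso_biprod (Set.Ici 2)
  obtain ⟨Y₃, Y₄, h₃, h₄, ⟨e'⟩⟩ := h₂.exists_iso_biprod (Set.Ici 0)
  obtain ⟨Y₅, Y₆, h₅, h₆, ⟨e''⟩⟩ := h₃.exists_iso_biprod {1}
  obtain ⟨a, ⟨i⟩⟩ := (h₅.mono (J := {1}) (by simp)).exists_iso_single
  obtain ⟨b, ⟨j⟩⟩ := (h₆.mono (J := {0}) (by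
    intro n
    simp only [Set.mem_inter_iff, Set.mem_sdiff, Set.mem_univ, Set.mem_Ici, Set.mem_singleton_iff]
    lia)).exists_iso_single
  let A' := Y₁⟦(-1 : ℤ)⟧
  have hA' : SumShifts ι (Set.Ici 1) A' := h₁.shift (-1) (by simp)
  let i' : A'⟦(1 : ℤ)⟧ ≅ Y₁ := shiftNegShift Y₁ 1
  let s : SplitData (A'⟦(1 : ℤ)⟧) Y Y₂ := .ofIso (e ≪≫ biprod.mapIso i'.symm (Iso.refl _))
  let s' : SplitData Y₃ Y₂ Y₄ := .ofIso e'
  let s'' : SplitData ((ι.obj a)⟦(1 : ℤ)⟧) Y₃ ((ι.obj b)⟦(0 : ℤ)⟧) :=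
    .ofIso (e'' ≪≫ biprod.mapIso i j)
  refine PreservesCone.of_comp_fst_eq_zero s ?_ ?_ f ?_ ?_
  · refine SumShifts.hom_eq_zero (h₁.of_iso i') h₂ (fun n hn m hm ↦ ?_)
    simp only [Set.mem_inter_iff, Set.mem_sdiff, Set.mem_univ, Set.mem_Ici] at hn hm
    lia
  · refine SumShifts.hom_eq_zero hA' hX (fun n hn m hm ↦ ?_)
    simp only [Set.mem_singleton_iff, Set.mem_Ici] at hn hm
    lia
  · refine SumShifts.hom_eq_zero hX (h₁.of_iso i') (fun n hn m hm ↦ ?_) _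
    simp only [Set.mem_inter_iff, Set.mem_univ, Set.mem_Ici, Set.mem_singleton_iff] at hn hm
    lia
  · refine PreservesCone.of_comp_snd_eq_zero s' ?_ _
      (hF.preservesCone_of_degrees_zero_one s'' _) ?_
    · refine SumShifts.hom_eq_zero h₃ h₄ (fun n hn m hm ↦ ?_)
      simp only [Set.mem_inter_iff, Set.mem_sdiff, Set.mem_univ, Set.mem_Ici] at hn hm
      lia
    · refine SumShifts.hom_eq_zero hX h₄ (fun n hn m hm ↦ ?_) _
      simp only [Set.mem_sdiff, Set.mem_univ, Set.mem_Ici, Set.mem_singleton_iff] at hn hm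
      lia

variable (hD : ∀ X : D, SumShifts ι Set.univ X)

include hD

lemma preservesCone_of_shift_source {X : A} {n : ℤ} {Y : D} (f : (ι.obj X)⟦n⟧ ⟶ Y) :
    F.PreservesCone f := by
  apply PreservesCone.of_shift (-n)
  exact .of_precomp_iso (shiftShiftNeg (ι.obj X) n).symm (hF.preservesCone_of_source (hD _) _)

/-- Induction on the range of shifts in the source, for arbitrary targets. The lowest shift is split
off because the higher ones have no nonzero morphisms to it. -/
lemma preservesCone {X Y : D} (f : X ⟶ Y) : F.PreservesCone f := by
  obtain ⟨n, N, hX⟩ := (hD X).exists_bounds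
  induction N generalizing n X Y with
  | zero =>
    rw [hX.hom_eq_zero (hD Y) (by simp) f]
    exact .zero _ _
  | succ N hN =>
    obtain ⟨X₁, X₂, h₁, h₂, ⟨e⟩⟩ := hX.exists_iso_biprod {n}
    obtain ⟨a, ⟨i⟩⟩ := (h₁.mono (J := {n}) (by simp)).exists_iso_single
    replace h₂ := h₂.mono (J := Set.Ico (n + 1) (n + 1 + N)) (by
      intro m
      simp only [Set.mem_sdiff, Set.mem_Ico, Set.mem_singleton_iff]
      lia)
    let s : SplitData ((ι.obj a)⟦n⟧) X X₂ := .ofIso (e ≪≫ biprod.mapIso i (Iso.refl _))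
    refine PreservesCone.of_source s ?_ f (hF.preservesCone_of_shift_source hD _)
      (fun C g ↦ hN _ _ h₂)
    refine SumShifts.hom_eq_zero h₂ (SumShifts.single a (Set.mem_singleton n))
      (fun p hp q hq ↦ ?_)
    simp only [Set.mem_singleton_iff, Set.mem_Ico] at hp hq
    lia

lemma isTriangulated : F.IsTriangulated where
  map_distinguished Δ hΔ := ((hF.preservesCone hD Δ.mor₁).biDistinguished hΔ).2

end PreservesExtensions

end Functor


/-! ### Transfer of hereditariness, and decomposition into shifts -/

section

variable {A D T : Type*} [Category* A] [Abelian A]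
  [Category* D] [HasZeroObject D] [HasShift D ℤ]
  [Preadditive D] [∀ n : ℤ, (shiftFunctor D n).Additive] [Pretriangulated D]
  [Category* T] [HasZeroObject T] [HasShift T ℤ]
  [Preadditive T] [∀ n : ℤ, (shiftFunctor T n).Additive] [Pretriangulated T]

open Functor.IsExtensionEmbedding

/-- Surjectivity of `Ext¹(Q, X) → Ext¹(Q, I)` is a statement about extensions in `A`, so it passes
from the hereditary `ι₂` to `ι₁`. -/
lemma ExtRel.exists_lift (ι₁ : A ⥤ D) [ι₁.IsExtensionEmbedding] (ι₂ : A ⥤ T)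
    [ι₂.IsHereditaryEmbedding] {X I Q : A} (p : X ⟶ I) [Epi p]
    (x : ι₁.obj Q ⟶ (ι₁.obj I)⟦(1 : ℤ)⟧) :
    ∃ y : ι₁.obj Q ⟶ (ι₁.obj X)⟦(1 : ℤ)⟧, y ≫ (ι₁.map p)⟦(1 : ℤ)⟧' = x := by
  obtain ⟨x', hx', -⟩ := ExtRel.existsUnique_right ι₂ x
  have hS : (ShortComplex.mk (kernel.ι p) p (kernel.condition p)).ShortExact :=
    { exact := ShortComplex.exact_of_f_is_kernel _ (kernelIsKernel p) }
  obtain ⟨h, hT⟩ := exists_distTriang (ι := ι₂) _ hS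
  obtain ⟨y', hy'⟩ := Functor.IsHereditaryEmbedding.exists_lift_ext ι₂ hT x'
  obtain ⟨y, hy, -⟩ := ExtRel.existsUnique_left ι₁ y'
  refine ⟨y, (ExtRel.existsUnique_left ι₁ x').unique ?_ hx'⟩
  have := hy.comp (𝟙 _) p
  rw [Functor.map_id, id_comp, Functor.map_id, id_comp] at this
  rwa [← hy']

/-- Effaceability writes every class of degree `n > 0` as a product of a class `δ` of degree 1 and
one of degree `n - 1`. This reduces the claim to degree 2 by induction. There the second factor is
the class of an extension with quotient map `b`, and `δ` lifts along `b`, so the product contains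
two consecutive morphisms of a triangle. -/
lemma Functor.IsHereditaryEmbedding.of_effaceable (ι₁ : A ⥤ D) [ι₁.IsExtensionEmbedding]
    (ι₂ : A ⥤ T) [ι₂.IsHereditaryEmbedding]
    (h : ∀ ⦃X Y : A⦄ (n : ℤ) (_ : 0 < n) (f : ι₁.obj X ⟶ (ι₁.obj Y)⟦n⟧),
      ∃ (X' : A) (p : X' ⟶ X), Epi p ∧ ι₁.map p ≫ f = 0) :
    ι₁.IsHereditaryEmbedding where
  hom_shift_eq_zero {X Y} n hn₀ hn₁ f := by
    obtain hn | hn := lt_or_gt_of_ne hn₀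
    · exact hom_shift_neg_eq_zero n hn f
    have fac (n m : ℤ) (hn : 0 < n) (hm : m + 1 = n) {X : A} (f : ι₁.obj X ⟶ (ι₁.obj Y)⟦n⟧) :
        ∃ (K : A) (δ : ι₁.obj X ⟶ (ι₁.obj K)⟦(1 : ℤ)⟧) (g : ι₁.obj K ⟶ (ι₁.obj Y)⟦m⟧),
          f = δ ≫ g⟦(1 : ℤ)⟧' ≫ (shiftFunctorAdd' D m 1 n hm).inv.app _ := by
      obtain ⟨X', p, hp, hpf⟩ := h _ hn f
      have hS : (ShortComplex.mk (kernel.ι p) p (kernel.condition p)).ShortExact :=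
        { exact := ShortComplex.exact_of_f_is_kernel _ (kernelIsKernel p) }
      obtain ⟨δ, hT⟩ := exists_distTriang (ι := ι₁) _ hS
      obtain ⟨g, hg⟩ := distTriang_yoneda₃ hT f hpf
      obtain ⟨g', hg'⟩ := (shiftFunctor D (1 : ℤ)).map_surjective
        (g ≫ (shiftFunctorAdd' D m 1 n hm).hom.app _)
      refine ⟨_, δ, g', ?_⟩
      rw [hg', assoc, Iso.hom_inv_id_app, comp_id, hg]
    have vanishing (k : ℕ) : ∀ (n : ℤ) (_ : n = k + 2) {X : A} (f : ι₁.obj X ⟶ (ι₁.obj Y)⟦n⟧),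
        f = 0 := by
      induction k with
      | zero =>
        rintro n hn X f
        obtain ⟨K, δ, g, rfl⟩ := fac n 1 (by lia) (by lia) f
        obtain ⟨E, a, b, hE⟩ := exists_extension g
        obtain ⟨_, hS⟩ := shortExact_of_distTriang ι₁ hE
        have : Epi b := hS.epi_g
        obtain ⟨y, rfl⟩ := ExtRel.exists_lift ι₁ ι₂ b δ
        rw [assoc, ← Functor.map_comp_assoc, distTriang_comp₂₃ hE, Functor.map_zero, zero_comp,
          comp_zero]
      | succ k hk =>
        rintro n hn X f
        obtain ⟨K, δ, g, rfl⟩ := fac n (k + 2) (by lia) (by lia) f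
        rw [hk _ rfl g, Functor.map_zero, zero_comp, comp_zero]
    exact vanishing (n - 2).toNat n (by lia) f

lemma Functor.IsExtensionEmbedding.of_comp (ι : A ⥤ D) (G : D ⥤ T) [G.CommShift ℤ]
    [G.IsTriangulated] [G.Full] [G.Faithful] [(ι ⋙ G).IsExtensionEmbedding] :
    ι.IsExtensionEmbedding where
  full := Functor.Full.of_comp_faithful ι G
  faithful := Functor.Faithful.of_comp ι G
  additive := Functor.additive_of_comp_faithful ι G
  hom_shift_neg_eq_zero {X Y} n hn f := by
    apply G.map_injective
    rw [← cancel_mono ((G.commShiftIso n).hom.app _), G.map_zero, zero_comp]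
    exact hom_shift_neg_eq_zero (ι := ι ⋙ G) n hn _
  exists_distTriang S hS := by
    obtain ⟨h, hT⟩ := exists_distTriang (ι := ι ⋙ G) S hS
    obtain ⟨h', hh'⟩ := G.map_surjective (h ≫ (G.commShiftIso (1 : ℤ)).inv.app _)
    refine ⟨h', (G.map_distinguished_iff _).1 ?_⟩
    obtain rfl : G.map h' ≫ (G.commShiftIso (1 : ℤ)).hom.app _ = h := by
      rw [hh', assoc, Iso.inv_hom_id_app]
      exact comp_id h
    exact hT
  exists_extension {X Z} h := by
    obtain ⟨Y, f, g, hT⟩ := exists_extension (ι := ι ⋙ G) (X := X) (Z := Z)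
      (G.map h ≫ (G.commShiftIso (1 : ℤ)).hom.app _)
    exact ⟨Y, f, g, (G.map_distinguished_iff _).1 hT⟩

lemma Functor.IsHereditaryEmbedding.of_comp (ι : A ⥤ D) (G : D ⥤ T) [G.CommShift ℤ]
    [G.IsTriangulated] [G.Full] [G.Faithful] [(ι ⋙ G).IsHereditaryEmbedding] :
    ι.IsHereditaryEmbedding where
  toIsExtensionEmbedding := .of_comp ι G
  hom_shift_eq_zero {X Y} n hn₀ hn₁ f := by
    apply G.map_injective
    rw [← cancel_mono ((G.commShiftIso n).hom.app _), G.map_zero, zero_comp]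
    exact hom_shift_eq_zero (ι := ι ⋙ G) n hn₀ hn₁ _

open Triangulated in
-- Induction on the amplitude: the lowest cohomology object splits off. An object in cohomological
-- degree `n` is a shift by `-n`, whence the reversed bounds.
lemma SumShifts.of_tStructure (t : TStructure D) (ι : A ⥤ D) [ι.IsHereditaryEmbedding]
    (h : ∀ (X : D) [t.IsGE X 0] [t.IsLE X 0], ∃ a : A, Nonempty (X ≅ ι.obj a))
    (X : D) (n m : ℤ) [t.IsGE X n] [t.IsLE X m] : SumShifts ι (Set.Icc (-m) (-n)) X := by
  obtain hnm | hnm := lt_or_ge m n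
  · exact .zero (t.isZero X m n hnm)
  obtain ⟨N, hN⟩ : ∃ N : ℕ, m = n + N := ⟨(m - n).toNat, by lia⟩
  clear hnm
  induction N generalizing n X with
  | zero =>
    obtain rfl : m = n := by lia
    have := t.isGE_shift X m m 0
    have := t.isLE_shift X m m 0
    obtain ⟨a, ⟨e⟩⟩ := h (X⟦m⟧)
    exact (SumShifts.single a (by simp)).of_iso
      ((shiftShiftNeg X m).symm ≪≫ (shiftFunctor D (-m)).mapIso e)
  | succ N hN' =>
    obtain ⟨L, R, hL, hR, f, g, δ, hT⟩ := t.exists_triangle X n (n + 1) rfl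
    rw [t.le_iff_isLE] at hL
    rw [t.ge_iff_isGE] at hR
    have := t.isGE_shift R (n + 1) (-1) (n + 2)
    have := t.isLE_shift L n 1 (n - 1)
    have hL' : t.IsGE L n := t.isGE₂ _ (inv_rot_of_distTriang _ hT) n
      (t.isGE_of_ge (R⟦(-1 : ℤ)⟧) n (n + 2)) (inferInstanceAs (t.IsGE X n))
    have hR' : t.IsLE R m := t.isLE₂ _ (rot_of_distTriang _ hT) m (inferInstanceAs (t.IsLE X m))
      (t.isLE_of_le (L⟦(1 : ℤ)⟧) (n - 1) m)
    have := t.isGE_shift L n n 0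
    have := t.isLE_shift L n n 0
    obtain ⟨a, ⟨e⟩⟩ := h (L⟦n⟧)
    have hL'' : SumShifts ι {-n} L := (SumShifts.single a (by simp)).of_iso
      ((shiftShiftNeg L n).symm ≪≫ (shiftFunctor D (-n)).mapIso e)
    have hR'' := hN' R (n + 1) (by lia)
    -- The shifts in `R` are at most `-n - 1`, while `L⟦1⟧` has shift `-n + 1`: the components of
    -- `δ` have degree at least 2.
    have hδ : δ = 0 := by
      refine hR''.hom_eq_zero (hL''.shift (J := {-n + 1}) 1 (by simp)) (fun i hi j hj ↦ ?_) δ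
      simp only [Set.mem_Icc, Set.mem_singleton_iff] at hi hj
      lia
    obtain ⟨e', -⟩ := exists_iso_binaryBiproduct_of_distTriang _ hT hδ
    refine (SumShifts.biprod (hL''.mono ?_) (hR''.mono ?_)).of_iso e'
    · intro i
      simp only [Set.mem_Icc, Set.mem_singleton_iff]
      lia
    · intro i
      simp only [Set.mem_Icc]
      lia

end

end CategoryTheory

/-! ### The bounded derived category -/

namespace DerivedCategory

open CategoryTheory Category Limits

variable {A : Type u} [Category.{v} A] [Abelian A] [HasDerivedCategory.{w} A]

/-- Represent `f` by a roof `X ← K → L` with `K` in degrees at most 0 and `L` in degrees at most -1.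
The degree zero term of `K` surjects onto `X`, and its map to `L` is zero. -/
lemma exists_epi_comp_eq_zero {X : A} {Y : DerivedCategory A} [Y.IsLE (-1)]
    (f : (singleFunctor A 0).obj X ⟶ Y) :
    ∃ (X' : A) (p : X' ⟶ X), Epi p ∧ (singleFunctor A 0).map p ≫ f = 0 := by
  obtain ⟨L, _, ⟨e⟩⟩ := exists_iso_Q_obj_of_isLE Y (-1)
  obtain ⟨φ, hφ⟩ : ∃ φ : Q.obj ((CochainComplex.singleFunctor A 0).obj X) ⟶ Q.obj L,
    φ = f ≫ e.hom := ⟨_, rfl⟩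
  obtain ⟨K, _, s, _, g, fac⟩ := right_fac_of_isStrictlyLE φ 0
  let j : (CochainComplex.singleFunctor A 0).obj (K.X 0) ⟶ K :=
    HomologicalComplex.mkHomFromSingle (𝟙 _) (fun i hi ↦
      (K.isZero_of_isStrictlyLE 0 i (by simp at hi; lia)).eq_of_tgt _ _)
  have hj : IsIso (j.f 0) := by
    rw [HomologicalComplex.mkHomFromSingle_f, comp_id]
    exact Iso.isIso_hom _
  obtain ⟨p, hp⟩ := (CochainComplex.singleFunctor A 0).map_surjective (j ≫ s)
  have hjg : j ≫ g = 0 := by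
    ext i
    by_cases hi : i = 0
    · subst hi
      exact (L.isZero_of_isStrictlyLE (-1) 0 (by lia)).eq_of_tgt _ _
    · exact (HomologicalComplex.isZero_single_obj_X _ _ _ _ hi).eq_of_src _ _
  refine ⟨K.X 0, p, ?_, ?_⟩
  · rw [Preadditive.epi_iff_cancel_zero]
    intro Z u hu
    have hsu : s ≫ (CochainComplex.singleFunctor A 0).map u = 0 := by
      ext i
      by_cases hi : i = 0
      · subst hi
        rw [← cancel_epi (j.f 0), ← HomologicalComplex.comp_f, ← assoc, ← hp, ← Functor.map_comp,
          hu, Functor.map_zero, HomologicalComplex.zero_f, HomologicalComplex.zero_f, comp_zero]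
      · exact (HomologicalComplex.isZero_single_obj_X _ _ _ _ hi).eq_of_tgt _ _
    apply (singleFunctor A 0).map_injective
    rw [Functor.map_zero]
    change Q.map ((CochainComplex.singleFunctor A 0).map u) = 0
    rw [← cancel_epi (Q.map s), ← Q.map_comp, hsu, Q.map_zero, comp_zero]
  · rw [← cancel_mono e.hom, zero_comp, assoc, ← hφ, fac]
    change Q.map ((CochainComplex.singleFunctor A 0).map p) ≫ _ = 0
    rw [hp, Q.map_comp, assoc, IsIso.hom_inv_id_assoc, ← Q.map_comp, hjg, Q.map_zero]

instance : (singleFunctor A 0).IsExtensionEmbedding where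
  full := inferInstance
  faithful := inferInstance
  additive := inferInstance
  hom_shift_neg_eq_zero {X Y} n hn f := by
    have := TStructure.t.isGE_shift ((singleFunctor A 0).obj Y) 0 n (-n) (by lia)
    exact TStructure.t.zero f 0 (-n) (by lia)
  exists_distTriang S hS := ⟨_, hS.singleTriangle_distinguished⟩
  exists_extension {X Z} h := by
    obtain ⟨Y, f, g, hT⟩ := distinguished_cocone_triangle₂ h
    have : Y.IsLE 0 := TStructure.t.isLE₂ _ hT 0
      (inferInstanceAs (((singleFunctor A 0).obj X).IsLE 0))
      (inferInstanceAs (((singleFunctor A 0).obj Z).IsLE 0))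
    have : Y.IsGE 0 := TStructure.t.isGE₂ _ hT 0
      (inferInstanceAs (((singleFunctor A 0).obj X).IsGE 0))
      (inferInstanceAs (((singleFunctor A 0).obj Z).IsGE 0))
    obtain ⟨B, ⟨e⟩⟩ := exists_iso_singleFunctor_obj_of_isGE_of_isLE Y 0
    obtain ⟨f', hf'⟩ := (singleFunctor A 0).map_surjective (f ≫ e.hom)
    obtain ⟨g', hg'⟩ := (singleFunctor A 0).map_surjective (e.inv ≫ g)
    refine ⟨B, f', g', distTriang_of_iso hT (Iso.refl _) e.symm (Iso.refl _) ?_ ?_ ?_⟩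
    · simp [hf']
    · simp [hg']
    · simp

lemma isHereditaryEmbedding_singleFunctor {T : Type*} [Category* T] [HasZeroObject T]
    [HasShift T ℤ] [Preadditive T] [∀ n : ℤ, (shiftFunctor T n).Additive] [Pretriangulated T]
    (ι : A ⥤ T) [ι.IsHereditaryEmbedding] : (singleFunctor A 0).IsHereditaryEmbedding := by
  refine .of_effaceable (singleFunctor A 0) ι (fun X Y n hn f ↦ ?_)
  have := TStructure.t.isLE_shift ((singleFunctor A 0).obj Y) 0 n (-n) (by lia)
  have : IsLE (((singleFunctor A 0).obj Y)⟦n⟧) (-1) := TStructure.t.isLE_of_le _ (-n) (-1)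
  exact exists_epi_comp_eq_zero f

namespace Bounded

lemma isHereditaryEmbedding_single₀ {T : Type*} [Category* T] [HasZeroObject T]
    [HasShift T ℤ] [Preadditive T] [∀ n : ℤ, (shiftFunctor T n).Additive] [Pretriangulated T]
    (ι : A ⥤ T) [ι.IsHereditaryEmbedding] : (single₀ A).IsHereditaryEmbedding := by
  have : (single₀ A ⋙ Bounded.ι).IsHereditaryEmbedding := isHereditaryEmbedding_singleFunctor ι
  exact .of_comp (single₀ A) Bounded.ι

lemma sumShifts [(single₀ A).IsHereditaryEmbedding] (X : Bounded A) :
    SumShifts (single₀ A) Set.univ X := by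
  obtain ⟨⟨n, hn⟩, ⟨m, hm⟩⟩ := X.property
  have := (TStructure.t.bounded.tStructure_isGE_iff TStructure.t X n).2 hn
  have := (TStructure.t.bounded.tStructure_isLE_iff TStructure.t X m).2 hm
  refine (SumShifts.of_tStructure TStructure.t.onBounded (single₀ A)
    (fun Y hY₁ hY₂ ↦ ?_) X n m).mono (Set.subset_univ _)
  have : IsGE Y.obj 0 := (TStructure.t.bounded.tStructure_isGE_iff TStructure.t Y 0).1 hY₁
  have : IsLE Y.obj 0 := (TStructure.t.bounded.tStructure_isLE_iff TStructure.t Y 0).1 hY₂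
  obtain ⟨a, ⟨e⟩⟩ := exists_iso_singleFunctor_obj_of_isGE_of_isLE Y.obj 0
  exact ⟨a, ⟨Bounded.ι.preimageIso e⟩⟩

end Bounded

end DerivedCategory

/-! ### Splitting of idempotents and closure under retracts -/

namespace CategoryTheory

open Category Preadditive ZeroObject

/-- The property that all the idempotent endomorphisms of an object split. -/
def IdempotentsSplitOn {C : Type*} [Category* C] : ObjectProperty C := fun X ↦
  ∀ p : X ⟶ X, p ≫ p = p → ∃ (Y : C) (i : Y ⟶ X) (e : X ⟶ Y), i ≫ e = 𝟙 Y ∧ e ≫ i = p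

namespace IdempotentsSplitOn

variable {C : Type*} [Category* C]

lemma of_isZero [HasZeroMorphisms C] {X : C} (hX : IsZero X) : IdempotentsSplitOn X :=
  fun _ _ ↦ ⟨X, 𝟙 X, 𝟙 X, comp_id _, hX.eq_of_src _ _⟩

lemma obj {A : Type*} [Category* A] [IsIdempotentComplete A] (F : A ⥤ C) [F.Full] [F.Faithful]
    (X : A) : IdempotentsSplitOn (F.obj X) := by
  intro p hp
  obtain ⟨q, rfl⟩ := F.map_surjective p
  obtain ⟨Y, i, e, h₁, h₂⟩ := IsIdempotentComplete.idempotents_split X q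
    (F.map_injective (by rw [F.map_comp, hp]))
  exact ⟨F.obj Y, F.map i, F.map e, by rw [← F.map_comp, h₁, F.map_id], by rw [← F.map_comp, h₂]⟩

lemma splits_of_splits {X : C} {p d : X ⟶ X} (hp : p ≫ p = p) (hpd : p ≫ d ≫ p = p)
    (hdp : d ≫ p ≫ d = d)
    (h : ∃ (Y : C) (i : Y ⟶ X) (e : X ⟶ Y), i ≫ e = 𝟙 Y ∧ e ≫ i = d) :
    ∃ (Y : C) (i : Y ⟶ X) (e : X ⟶ Y), i ≫ e = 𝟙 Y ∧ e ≫ i = p := by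
  obtain ⟨Y, i, e, hie, rfl⟩ := h
  refine ⟨Y, i ≫ p, p ≫ e, ?_, ?_⟩
  · have := i ≫= hdp =≫ e
    simpa only [assoc, hie, comp_id, reassoc_of% hie, reassoc_of% hp] using this
  · simpa only [assoc] using hpd

variable [Preadditive C] [HasBinaryBiproducts C]

/-- The idempotent `p` is triangular, with diagonal entries `a`, `b` and off-diagonal entry `c`. Its
diagonal part `d` splits by hypothesis, and `pdp = p`, `dpd = d`, so `p` splits through the same
object. -/
lemma of_splitData {A S B : C} (s : SplitData A S B) (hBA : ∀ φ : B ⟶ A, φ = 0)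
    (hA : IdempotentsSplitOn A) (hB : IdempotentsSplitOn B) : IdempotentsSplitOn S := by
  intro p hp
  obtain ⟨a, ha⟩ : ∃ a, a = s.inl ≫ p ≫ s.fst := ⟨_, rfl⟩
  obtain ⟨b, hb⟩ : ∃ b, b = s.inr ≫ p ≫ s.snd := ⟨_, rfl⟩
  obtain ⟨c, hc⟩ : ∃ c, c = s.inl ≫ p ≫ s.snd := ⟨_, rfl⟩
  have h₁ := s.inl_fst
  have h₂ := s.inr_snd
  have h₃ := s.inl_snd
  have h₄ := s.inr_fst
  have h₁' : p = s.fst ≫ a ≫ s.inl + s.fst ≫ c ≫ s.inr + s.snd ≫ b ≫ s.inr := by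
    have h₀ := hBA (s.inr ≫ p ≫ s.fst)
    apply s.hom_ext <;> apply s.hom_ext' <;>
      simp only [ha, hb, hc, h₀, add_comp, comp_add, assoc, reassoc_of% h₁, reassoc_of% h₂,
        reassoc_of% h₃, reassoc_of% h₄, h₁, h₂, h₃, h₄, comp_id, comp_zero, zero_comp, add_zero,
        zero_add]
  have haa : a ≫ a = a := by
    have := s.inl ≫= hp =≫ s.fst
    rw [h₁'] at this
    simpa only [add_comp, comp_add, assoc, reassoc_of% h₁, reassoc_of% h₂,
        reassoc_of% h₃, reassoc_of% h₄, h₁, h₂, h₃, h₄, comp_id, comp_zero, zero_comp, add_zero,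
        zero_add] using this
  have hbb : b ≫ b = b := by
    have := s.inr ≫= hp =≫ s.snd
    rw [h₁'] at this
    simpa only [add_comp, comp_add, assoc, reassoc_of% h₁, reassoc_of% h₂,
        reassoc_of% h₃, reassoc_of% h₄, h₁, h₂, h₃, h₄, comp_id, comp_zero, zero_comp, add_zero,
        zero_add] using this
  have hcc : a ≫ c + c ≫ b = c := by
    have := s.inl ≫= hp =≫ s.snd
    rw [h₁'] at this
    simpa only [add_comp, comp_add, assoc, reassoc_of% h₁, reassoc_of% h₂,
        reassoc_of% h₃, reassoc_of% h₄, h₁, h₂, h₃, h₄, comp_id, comp_zero, zero_comp, add_zero,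
        zero_add] using this
  have hacb : a ≫ c ≫ b = 0 := by
    have := a ≫= hcc
    rwa [comp_add, reassoc_of% haa, add_eq_left] at this
  obtain ⟨Y, i, e, hie, hei⟩ := hA a haa
  obtain ⟨Y', i', e', hie', hei'⟩ := hB b hbb
  refine splits_of_splits (d := s.fst ≫ a ≫ s.inl + s.snd ≫ b ≫ s.inr) hp ?_ ?_
    ⟨Y ⊞ Y', biprod.desc (i ≫ s.inl) (i' ≫ s.inr), biprod.lift (s.fst ≫ e) (s.snd ≫ e'), ?_, ?_⟩
  · have : s.fst ≫ c ≫ s.inr = s.fst ≫ a ≫ c ≫ s.inr + s.fst ≫ c ≫ b ≫ s.inr := by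
      nth_rw 1 [← hcc]
      simp only [add_comp, comp_add, assoc]
    rw [h₁']
    simp only [add_comp, comp_add, assoc, reassoc_of% h₁, reassoc_of% h₂,
      reassoc_of% h₃, reassoc_of% h₄, reassoc_of% haa, reassoc_of% hbb, zero_comp, comp_zero,
      add_zero, zero_add]
    rw [this]
    abel
  · rw [h₁']
    simp only [add_comp, comp_add, assoc, reassoc_of% h₁, reassoc_of% h₂,
      reassoc_of% h₃, reassoc_of% h₄, reassoc_of% haa, reassoc_of% hbb, reassoc_of% hacb,
      zero_comp, comp_zero, add_zero, zero_add]
  · ext <;> simp [hie, hie', reassoc_of% h₁, reassoc_of% h₂, reassoc_of% h₃, reassoc_of% h₄]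
  · rw [biprod.lift_desc, ← hei, ← hei']
    simp only [assoc]

end IdempotentsSplitOn

/-- A retract of `F.obj Z` gives an idempotent of `F.obj Z`; full faithfulness moves it to `Z`,
where it splits. -/
lemma isStableUnderRetracts_essImage {C D : Type*} [Category* C] [Category* D]
    [IsIdempotentComplete C] (F : C ⥤ D) [F.Full] [F.Faithful] :
    F.essImage.IsStableUnderRetracts where
  of_retract := by
    rintro X Y r ⟨Z, ⟨e⟩⟩
    have hr : (e.hom ≫ r.r ≫ r.i ≫ e.inv) ≫ (e.hom ≫ r.r ≫ r.i ≫ e.inv) =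
        e.hom ≫ r.r ≫ r.i ≫ e.inv := by simp
    obtain ⟨q, hq⟩ := F.map_surjective (e.hom ≫ r.r ≫ r.i ≫ e.inv)
    obtain ⟨W, i, p, hip, rfl⟩ := IsIdempotentComplete.idempotents_split Z q
      (F.map_injective (by rw [F.map_comp, hq, hr]))
    rw [F.map_comp] at hq
    have hip' : F.map i ≫ F.map p = 𝟙 _ := by rw [← F.map_comp, hip, F.map_id]
    refine ⟨W, ⟨{ hom := F.map i ≫ e.hom ≫ r.r, inv := r.i ≫ e.inv ≫ F.map p,
                  hom_inv_id := ?_, inv_hom_id := ?_ }⟩⟩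
    · have := F.map i ≫= hq.symm =≫ F.map p
      simpa [hip', reassoc_of% hip'] using this
    · have := r.i ≫= e.inv ≫= hq =≫ (e.hom ≫ r.r)
      simpa using this

section

variable {A D : Type*} [Category* A] [Abelian A]
  [Category* D] [HasZeroObject D] [HasShift D ℤ]
  [Preadditive D] [∀ n : ℤ, (shiftFunctor D n).Additive] [Pretriangulated D]
  {ι : A ⥤ D}

lemma SumShifts.idempotentsSplitOn [ι.IsHereditaryEmbedding] {I : Set ℤ} {X : D}
    (h : SumShifts ι I X) : IdempotentsSplitOn X := by
  obtain ⟨n, N, hX⟩ := h.exists_bounds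
  clear h
  induction N generalizing n X with
  | zero => exact .of_isZero ((IsZero.iff_id_eq_zero _).2 (hX.hom_eq_zero hX (by simp) _))
  | succ N hN =>
    obtain ⟨X₁, X₂, h₁, h₂, ⟨e⟩⟩ := hX.exists_iso_biprod {n}
    obtain ⟨a, ⟨i⟩⟩ := (h₁.mono (J := {n}) (by simp)).exists_iso_single
    replace h₂ := h₂.mono (J := Set.Ico (n + 1) (n + 1 + N)) (by
      intro m
      simp only [Set.mem_sdiff, Set.mem_Ico, Set.mem_singleton_iff]
      lia)
    refine .of_splitData (.ofIso (e ≪≫ biprod.mapIso i (Iso.refl _))) ?_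
      (.obj (ι ⋙ shiftFunctor D n) a) (hN _ h₂)
    refine h₂.hom_eq_zero (SumShifts.single a (Set.mem_singleton n)) (fun p hp q hq ↦ ?_)
    simp only [Set.mem_singleton_iff, Set.mem_Ico] at hp hq
    lia

lemma SumShifts.prop_of_isTriangulated {I : Set ℤ} {X : D} (hX : SumShifts ι I X)
    (P : ObjectProperty D) [P.IsTriangulated] [P.IsClosedUnderIsomorphisms]
    (hP : ∀ a, P (ι.obj a)) : P X := by
  induction hX with
  | zero hX => exact P.prop_of_isZero hX
  | add a i _ _ e h => exact P.prop_of_iso e.symm (P.ext_of_isTriangulatedClosed₂ _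
      (binaryBiproductTriangle_distinguished _ _) (P.le_shift i _ (hP a)) h)

end

/-! ### The inclusion of `H` and the main theorem -/

namespace ObjectProperty

variable {T : Type u} [Category.{v} T] [HasZeroObject T] [HasShift T ℤ] [Preadditive T]
  [∀ n : ℤ, (shiftFunctor T n).Additive] [Pretriangulated T] (H : ObjectProperty T)

instance [H.IsAdmissibleAbelian] [H.IsAdmissibleHereditary] : H.ι.IsHereditaryEmbedding where
  full := inferInstance
  faithful := inferInstance
  additive := inferInstance
  hom_shift_neg_eq_zero {X Y} n hn f :=
    IsAdmissibleHereditary.hom_shift_eq_zero X.property Y.property n (by lia) (by lia) f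
  hom_shift_eq_zero {X Y} n hn₀ hn₁ f :=
    IsAdmissibleHereditary.hom_shift_eq_zero X.property Y.property n hn₀ hn₁ f
  exists_distTriang S hS := IsAdmissibleAbelian.exists_distTriang S hS
  exists_extension {X Z} h := by
    obtain ⟨Y, f, g, hT⟩ := distinguished_cocone_triangle₂ h
    exact ⟨⟨Y, IsAdmissible.prop_of_distTriang _ hT X.property Z.property⟩, ⟨f⟩, ⟨g⟩, hT⟩

end ObjectProperty

end CategoryTheory

theorem mainTheorem1 {T : Type u} [Category.{v} T] [HasZeroObject T] [HasShift T ℤ] [Preadditive T]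
    [∀ n : ℤ, (shiftFunctor T n).Additive] [Pretriangulated T] [IsTriangulated T]
    (H : ObjectProperty T) [H.IsAdmissibleAbelian] [H.IsAdmissibleHereditary]
    [HasDerivedCategory.{w} H.FullSubcategory] :
    ∃ (F : DerivedCategory.Bounded H.FullSubcategory ⥤ H.triangEnvelope.FullSubcategory)
      (_ : F.CommShift ℤ), F.IsTriangulated ∧ F.IsEquivalence ∧
      Nonempty (DerivedCategory.Bounded.single₀ H.FullSubcategory ⋙ F ≅
        H.ιOfLE H.le_triangEnvelope) := by
  let ι := DerivedCategory.Bounded.single₀ H.FullSubcategory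
  have : ι.IsHereditaryEmbedding := DerivedCategory.Bounded.isHereditaryEmbedding_single₀ H.ι
  have hD := DerivedCategory.Bounded.sumShifts (A := H.FullSubcategory)
  have : IsIdempotentComplete (DerivedCategory.Bounded H.FullSubcategory) :=
    ⟨fun X ↦ (hD X).idempotentsSplitOn⟩
  obtain ⟨c⟩ := nonempty_matchChoice H.ι hD
  have : c.functor.IsTriangulated := Functor.PreservesExtensions.isTriangulated (ι := ι)
    (fun X Y Z f g h hT ↦ c.mapTriangle_distinguished hT) hD
  -- The values are finite sums of shifts of objects of `H`, so they lie in the thick subcategory.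
  -- The reverse inclusion `hH` is minimality, as the essential image is triangulated and closed
  -- under retracts.
  have hc (X) : H.triangEnvelope (c.functor.obj X) :=
    (c.sumShifts X).prop_of_isTriangulated _ (fun a ↦ H.le_triangEnvelope _ a.property)
  have := isStableUnderRetracts_essImage c.functor
  have hH : H.triangEnvelope ≤ c.functor.essImage := by
    rw [ObjectProperty.triangEnvelope_le_iff]
    exact fun X hX ↦ ⟨ι.obj ⟨X, hX⟩, ⟨c.compFunctorIso.app ⟨X, hX⟩⟩⟩
  have : (H.triangEnvelope.lift c.functor hc).EssSurj := ⟨fun X ↦ by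
    obtain ⟨Y, ⟨e⟩⟩ := hH _ X.property
    exact ⟨Y, ⟨H.triangEnvelope.ι.preimageIso e⟩⟩⟩
  refine ⟨H.triangEnvelope.lift c.functor hc, inferInstance, inferInstance, { }, ⟨?_⟩⟩
  exact (H.triangEnvelope.fullyFaithfulι.whiskeringRight _).preimageIso c.compFunctorIso
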